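/- **Conventions.** A $1$-category is described by its arrows under a partially defined associative composition, its objects being the partial identities. A strict globular $n$-category $(\mathcal C,\circ_0,\dots,\circ_{n-1})$ is a set with $n$ such compositions such that, writing $\mathcal C^p$ for the set of $\circ_p$-identities and $\mathcal C^n:=\mathcal C$, for $q<p$: $\mathcal C^q\subset\mathcal C^p$, $\ \mathcal C^p\circ_q\mathcal C^p\subset\mathcal C^p$, and whenever $(x\circ_p y)\circ_q(w\circ_p z)$ exists, so does $(x\circ_q w)\circ_p(y\circ_q z)$ and they coincide. The block $\mathcal C_{ab}$ ($a,b\in\mathcal C^{n-1}$) is the set of $n$-arrows with $(n-1)$-target $a$ and $(n-1)$-source $b$. Let $n\ge1$. A *strict globular $n$-C\*-category of Longo–Roberts type* is a strict globular $n$-category $\mathcal C$ with an involution $*_{n-1}:\mathcal C\to\mathcal C$ and partial linear operations and a norm on the blocks such that: * for all $a,b\in\mathcal C^{n-1}$ in globular position (equal $p$-sources and equal $p$-targets for all $p<n-1$) the block $\mathcal C_{ab}$ is a complex Banach space; * all compositions $\circ_0,\dots,\circ_{n-1}$ are bilinear on composable blocks and satisfy $\|x\circ_p y\|\le\|x\|\,\|y\|$;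 * $*_{n-1}$ is involutive, conjugate-linear on blocks, trivial on $\mathcal C^{n-1}$, contravariant for $\circ_{n-1}$ and covariant for $\circ_k$, $k<n-1$; * $\|x^{*_{n-1}}\circ_{n-1}x\|=\|x\|^2$, and $x^{*_{n-1}}\circ_{n-1}x$ is positive in the unital C\*-algebra $\mathcal C_{ee}$, where $e$ is the $(n-1)$-source of $x$. A *$*$-functor* is a map preserving all compositions, all identities, the involution and the linear operations. Given $*$-functors $\Phi,\Psi:\mathcal C\to\mathcal D$, a *bounded strict $1$-transfor* $\Phi\to\Psi$ is a map $\Xi:\mathcal C^0\to\mathcal D^1$ such that $\Xi(A)$ has $0$-source $\Phi(A)$ and $0$-target $\Psi(A)$, $\ \Psi(x)\circ_0\Xi(A)=\Xi(B)\circ_0\Phi(x)$ for every $x\in\mathcal C$ with $0$-source $A$ and $0$-target $B$, and $\sup_{A\in\mathcal C^0}\|\Xi(A)\|<\infty$. For $1\le k<n$, a *bounded strict $(k+1)$-transfor* between bounded strict $k$-transfors $\Theta,\Omega$ (over the same $\Phi,\Psi$) is a map $\Xi:\mathcal C^0\to\mathcal D^{k+1}$ such that $\Xi(A)$ has $k$-source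 $\Theta(A)$ and $k$-target $\Omega(A)$, with the same intertwining and boundedness conditions. **Proposition.** For every $n\ge1$, the bounded strict $n$-transfors $\Xi$ between $*$-functors of small strict globular $n$-C\*-categories of Longo–Roberts type form a strict globular $(n+1)$-C\*-category of Longo–Roberts type, with the following structure: * for $X:\Phi_X\to\Psi_X$ from $\mathcal D$ to $\mathcal E$ and $Y:\Phi_Y\to\Psi_Y$ from $\mathcal C$ to $\mathcal D$, the composite $X\circ_0Y$, from $\Phi_X\circ\Phi_Y$ to $\Psi_X\circ\Psi_Y$, is $(X\circ_0Y)(A)=X(\Psi_Y(A))\circ_0\Phi_X(Y(A))$; * $(X\circ_1Y)(A)=X(A)\circ_0Y(A)$, defined when $\Phi_X=\Psi_Y$, and going from $\Phi_Y$ to $\Psi_X$; * for $2\le k\le n$, $(X\circ_kY)(A)=X(A)\circ_{k-1}Y(A)$, defined when $X,Y$ lie between the same two $*$-functors and all these composites exist; * addition (on blocks), multiplication by scalars and the involution are componentwise: $(X+Y)(A)=X(A)+Y(A)$, $(cX)(A)=c\,X(A)$, $X^{*_n}(A)=X(A)^{*_{n-1}}$; the involution exchanges the two bounding $*$-functors if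 $n=1$ and the two bounding $(n-1)$-transfors if $n\ge2$; * the norm is $\|X\|=\sup_{A\in\mathcal C^0}\|X(A)\|$ (equal to $0$ if $\mathcal C^0=\emptyset$). -/

import Mathlib

universe u

namespace HigherCStar

/-! ### Categories as partial monoids -/

/-- `e` is a partial identity of the partial binary operation `comp`:
`h ∘ e = h` and `e ∘ h = h` whenever these composites exist. -/
def IsPartialId {C : Type u} (comp : C → C → Part C) (e : C) : Prop :=
  (∀ h k, k ∈ comp h e → k = h) ∧ (∀ h k, k ∈ comp e h → k = h)

/-- `e` is a partial identity and `x ∘ e` exists: `e` is the source of `x`. -/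
def IsSource {C : Type u} (comp : C → C → Part C) (x e : C) : Prop :=
  IsPartialId comp e ∧ (comp x e).Dom

/-- `e` is a partial identity and `e ∘ x` exists: `e` is the target of `x`. -/
def IsTarget {C : Type u} (comp : C → C → Part C) (x e : C) : Prop :=
  IsPartialId comp e ∧ (comp e x).Dom

/-- A `1`-category, described by its arrows under a partially defined composition. -/
structure IsPartialCategory {C : Type u} (comp : C → C → Part C) : Prop where
  /-- `f ∘ (g ∘ h)` and `(f ∘ g) ∘ h` exist simultaneously and then coincide. -/
  assoc : ∀ f g h, ((comp g h).bind fun k => comp f k) = ((comp f g).bind fun k => comp k h)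
  exists_source : ∀ f, ∃ r, IsSource comp f r
  exists_target : ∀ f, ∃ l, IsTarget comp f l
  dom_of_match : ∀ f g e, IsSource comp f e → IsTarget comp g e → (comp f g).Dom

/-- A strict globular `n`-category, described by its `n`-arrows: compositions `∘₀, …, ∘ₙ₋₁`
with the usual exchange property. -/
structure GlobularCategory (n : ℕ) (C : Type u) where
  comp : Fin n → C → C → Part C
  isCategory : ∀ p, IsPartialCategory (comp p)
  id_mono : ∀ q p, q < p → ∀ e, IsPartialId (comp q) e → IsPartialId (comp p) e
  id_comp_id : ∀ q p, q < p → ∀ e f g, IsPartialId (comp p) e → IsPartialId (comp p) f →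
    g ∈ comp q e f → IsPartialId (comp p) g
  /-- If `(x ∘ₚ y) ∘_q (w ∘ₚ z)` exists, then `(x ∘_q w) ∘ₚ (y ∘_q z)` exists and is equal to it. -/
  exchange : ∀ q p, q < p → ∀ x y w z a b c, a ∈ comp p x y → b ∈ comp p w z → c ∈ comp q a b →
    ∃ d e, d ∈ comp q x w ∧ e ∈ comp q y z ∧ c ∈ comp p d e

namespace GlobularCategory

/-- The `k`-arrows `Cᵏ`: the `∘ₖ`-identities for `k < n`, and all cells for `k = n`. -/
def level {n : ℕ} {C : Type u} (G : GlobularCategory n C) (k : ℕ) : Set C :=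
  {x | ∀ h : k < n, IsPartialId (G.comp ⟨k, h⟩) x}

/-- The block of `n`-arrows (where `n = m + 1`) with `(n-1)`-target `a` and `(n-1)`-source `b`. -/
def block {m : ℕ} {C : Type u} (G : GlobularCategory (m + 1) C) (a b : C) : Set C :=
  {x | IsTarget (G.comp (Fin.last m)) x a ∧ IsSource (G.comp (Fin.last m)) x b}

/-- `a` and `b` are `(n-1)`-arrows (where `n = m + 1`) in globular position: they have the same
`p`-source and the same `p`-target for every `p < n - 1`. For `n = 1` these are just two objects. -/
def Parallel {m : ℕ} {C : Type u} (G : GlobularCategory (m + 1) C) (a b : C) : Prop :=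
  a ∈ G.level m ∧ b ∈ G.level m ∧ ∀ p < Fin.last m,
    (∀ e, IsSource (G.comp p) a e ↔ IsSource (G.comp p) b e) ∧
    (∀ e, IsTarget (G.comp p) a e ↔ IsTarget (G.comp p) b e)

end GlobularCategory

/-! ### Higher C*-categories of Longo-Roberts type -/

/-- The structure of a strict globular `n`-C*-category of Longo-Roberts type on `C`, where
`n = m + 1`: a strict globular `n`-category with one involution `*ₙ₋₁`, linear operations and
a norm on the blocks of `n`-arrows. -/
structure LRStructure (m : ℕ) (C : Type u) extends GlobularCategory (m + 1) C where
  star : C → C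
  add : C → C → Part C
  smul : ℂ → C → C
  norm : C → ℝ
  /-- Addition is defined exactly inside the blocks. -/
  add_dom : ∀ x y, (add x y).Dom ↔
    ∃ a b, x ∈ toGlobularCategory.block a b ∧ y ∈ toGlobularCategory.block a b
  /-- The block of two `(n-1)`-arrows in globular position is a complex Banach space. -/
  banach : ∀ a b, toGlobularCategory.Parallel a b →
    ∃ (_ : NormedAddCommGroup (toGlobularCategory.block a b))
      (_ : NormedSpace ℂ (toGlobularCategory.block a b)),
      CompleteSpace (toGlobularCategory.block a b) ∧
      (∀ x y : toGlobularCategory.block a b,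
        ((x + y : toGlobularCategory.block a b) : C) ∈ add x y) ∧
      (∀ (c : ℂ) (x : toGlobularCategory.block a b),
        ((c • x : toGlobularCategory.block a b) : C) = smul c x) ∧
      (∀ x : toGlobularCategory.block a b, ‖x‖ = norm x)
  /-- Every composition `∘ₚ` is bilinear on composable blocks (four conditions). -/
  add_comp : ∀ p x x' y u a b, u ∈ add x x' → a ∈ comp p x y → b ∈ comp p x' y →
    ∃ v, v ∈ comp p u y ∧ v ∈ add a b
  comp_add : ∀ p x y y' u a b, u ∈ add y y' → a ∈ comp p x y → b ∈ comp p x y' →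
    ∃ v, v ∈ comp p x u ∧ v ∈ add a b
  smul_comp : ∀ p c x y z, z ∈ comp p x y → smul c z ∈ comp p (smul c x) y
  comp_smul : ∀ p c x y z, z ∈ comp p x y → smul c z ∈ comp p x (smul c y)
  /-- Every composition `∘ₚ` is norm submultiplicative. -/
  norm_comp_le : ∀ p x y z, z ∈ comp p x y → norm z ≤ norm x * norm y
  star_star : ∀ x, star (star x) = x
  /-- The involution is trivial on `(n-1)`-arrows. -/
  star_id : ∀ e, IsPartialId (comp (Fin.last m)) e → star e = e
  /-- The involution is conjugate-linear on blocks. -/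
  star_add : ∀ x y z, z ∈ add x y → star z ∈ add (star x) (star y)
  star_smul : ∀ (c : ℂ) x, star (smul c x) = smul (starRingEnd ℂ c) (star x)
  /-- The involution is contravariant for `∘ₙ₋₁`. -/
  star_comp_top : ∀ x y z, z ∈ comp (Fin.last m) x y → star z ∈ comp (Fin.last m) (star y) (star x)
  /-- The involution is covariant for `∘ₖ`, `k < n - 1`. -/
  star_comp : ∀ k < Fin.last m, ∀ x y z, z ∈ comp k x y → star z ∈ comp k (star x) (star y)
  /-- The C*-property. -/
  norm_star_comp_self : ∀ x z, z ∈ comp (Fin.last m) (star x) x → norm z = norm x ^ 2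
  /-- `x* ∘ₙ₋₁ x` is positive in the unital C*-algebra of the `n`-arrows from `e` to `e`, where `e`
  is the `(n-1)`-source of `x`: it is of the form `y* ∘ₙ₋₁ y` with `y` in this C*-algebra. -/
  star_comp_self_pos : ∀ x e z, IsSource (comp (Fin.last m)) x e →
    z ∈ comp (Fin.last m) (star x) x →
    ∃ y ∈ toGlobularCategory.block e e, z ∈ comp (Fin.last m) (star y) y

/-- A small strict globular `(m+1)`-C*-category of Longo-Roberts type. -/
structure SmallLR (m : ℕ) : Type (u + 1) where
  carrier : Type u
  str : LRStructure m carrier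

/-- The set `C⁰` of objects. -/
def SmallLR.Obj {m : ℕ} (C : SmallLR.{u} m) : Type u :=
  {x : C.carrier // IsPartialId (C.str.comp 0) x}

/-- A (blockwise linear) `*`-functor. -/
@[ext]
structure StarFunctor {m : ℕ} (C D : SmallLR.{u} m) where
  toFun : C.carrier → D.carrier
  map_comp : ∀ p x y z, z ∈ C.str.comp p x y → toFun z ∈ D.str.comp p (toFun x) (toFun y)
  map_id : ∀ p e, IsPartialId (C.str.comp p) e → IsPartialId (D.str.comp p) (toFun e)
  map_star : ∀ x, toFun (C.str.star x) = D.str.star (toFun x)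
  map_add : ∀ x y z, z ∈ C.str.add x y → toFun z ∈ D.str.add (toFun x) (toFun y)
  map_smul : ∀ (c : ℂ) x, toFun (C.str.smul c x) = D.str.smul c (toFun x)

/-- The action of a `*`-functor on objects. -/
def StarFunctor.onObj {m : ℕ} {C D : SmallLR.{u} m} (F : StarFunctor C D) (A : C.Obj) : D.Obj :=
  ⟨F.toFun A.1, F.map_id 0 A.1 A.2⟩

/-! ### Bounded transfors -/

/-- The intertwining condition `Ψ(x) ∘₀ Ξ(x₀) = Ξ(₀x) ∘₀ Φ(x)` for all cells `x`, where `x₀` and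
`₀x` are the source and the target object of `x`. -/
def Intertwines {m : ℕ} {C D : SmallLR.{u} m} (Φ Ψ : StarFunctor C D)
    (Ξ : C.Obj → D.carrier) : Prop :=
  ∀ (x : C.carrier) (A B : C.Obj),
    IsSource (C.str.comp 0) x A.1 → IsTarget (C.str.comp 0) x B.1 →
    D.str.comp 0 (Ψ.toFun x) (Ξ A) = D.str.comp 0 (Ξ B) (Φ.toFun x)

/-- `sup_A ‖Ξ(A)‖ < ∞`. -/
def IsBoundedFamily {m : ℕ} {C D : SmallLR.{u} m} (Ξ : C.Obj → D.carrier) : Prop :=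
  BddAbove (Set.range fun A => D.str.norm (Ξ A))

/-- `IsTransfor Φ Ψ k Ξ`: the map `Ξ : C⁰ → Dᵏ` is a bounded strict `k`-transfor (`1 ≤ k ≤ n`,
where `n = m + 1`) between `(k-1)`-transfors, …, between the two `*`-functors `Φ` and `Ψ`. -/
inductive IsTransfor {m : ℕ} {C D : SmallLR.{u} m} (Φ Ψ : StarFunctor C D) :
    ℕ → (C.Obj → D.carrier) → Prop
  /-- `1`-transfors `Ξ : Φ → Ψ`. -/
  | one (Ξ : C.Obj → D.carrier)
      (mem_level : ∀ A, Ξ A ∈ D.str.level 1)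
      (source : ∀ A, IsSource (D.str.comp 0) (Ξ A) (Φ.toFun A.1))
      (target : ∀ A, IsTarget (D.str.comp 0) (Ξ A) (Ψ.toFun A.1))
      (intertwines : Intertwines Φ Ψ Ξ)
      (bounded : IsBoundedFamily Ξ) :
      IsTransfor Φ Ψ 1 Ξ
  /-- `(k+1)`-transfors `Ξ : Θ → Ω` between two `k`-transfors `Θ` and `Ω`. -/
  | succ (k : ℕ) (hk : k < m + 1) (Θ Ω Ξ : C.Obj → D.carrier)
      (isTransfor_source : IsTransfor Φ Ψ k Θ)
      (isTransfor_target : IsTransfor Φ Ψ k Ω)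
      (mem_level : ∀ A, Ξ A ∈ D.str.level (k + 1))
      (source : ∀ A, IsSource (D.str.comp ⟨k, hk⟩) (Ξ A) (Θ A))
      (target : ∀ A, IsTarget (D.str.comp ⟨k, hk⟩) (Ξ A) (Ω A))
      (intertwines : Intertwines Φ Ψ Ξ)
      (bounded : IsBoundedFamily Ξ) :
      IsTransfor Φ Ψ (k + 1) Ξ

/-- A bounded strict `n`-transfor (`n = m + 1`) from `C` to `D`. The lower transfors between which
it lives need not be recorded: they are the `j`-sources and `j`-targets of the components. -/
structure NTransfor {m : ℕ} (C D : SmallLR.{u} m) where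
  src : StarFunctor C D
  tgt : StarFunctor C D
  map : C.Obj → D.carrier
  isTransfor : IsTransfor src tgt (m + 1) map

/-- The cells of the category of small strict globular `n`-C*-categories of Longo-Roberts type
(`n = m + 1`): the bounded strict `n`-transfors. -/
structure Cell (m : ℕ) : Type (u + 1) where
  dom : SmallLR.{u} m
  cod : SmallLR.{u} m
  transfor : NTransfor dom cod

/-- `IsTransforComp k X Y Z`: the composite `X ∘ₖ Y` exists and is `Z`. -/
inductive IsTransforComp {m : ℕ} : Fin (m + 1 + 1) → Cell.{u} m → Cell.{u} m → Cell.{u} m → Prop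
  /-- Composition over objects:
  `(X ∘₀ Y)(A) = X(Ψ_Y(A)) ∘₀ Φ_X(Y(A))`, where `Y : Φ_Y → Ψ_Y` and `X : Φ_X → Ψ_X`. -/
  | zero {C D E : SmallLR.{u} m} (X : NTransfor D E) (Y : NTransfor C D) (Z : NTransfor C E)
      (src : ∀ x, Z.src.toFun x = X.src.toFun (Y.src.toFun x))
      (tgt : ∀ x, Z.tgt.toFun x = X.tgt.toFun (Y.tgt.toFun x))
      (map : ∀ A, Z.map A ∈ E.str.comp 0 (X.map (Y.tgt.onObj A)) (X.src.toFun (Y.map A))) :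
      IsTransforComp 0 ⟨D, E, X⟩ ⟨C, D, Y⟩ ⟨C, E, Z⟩
  /-- Composition over `*`-functors: `(X ∘₁ Y)(A) = X(A) ∘₀ Y(A)`. -/
  | one {C D : SmallLR.{u} m} (X Y Z : NTransfor C D)
      (middle : X.src = Y.tgt) (src : Z.src = Y.src) (tgt : Z.tgt = X.tgt)
      (map : ∀ A, Z.map A ∈ D.str.comp 0 (X.map A) (Y.map A)) :
      IsTransforComp (Fin.succ 0) ⟨C, D, X⟩ ⟨C, D, Y⟩ ⟨C, D, Z⟩
  /-- Composition over `j`-transfors, `j ≥ 1`: `(X ∘ⱼ₊₁ Y)(A) = X(A) ∘ⱼ Y(A)`. -/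
  | succ {C D : SmallLR.{u} m} (j : Fin (m + 1)) (hj : j ≠ 0) (X Y Z : NTransfor C D)
      (src_left : Z.src = X.src) (src_right : Z.src = Y.src)
      (tgt_left : Z.tgt = X.tgt) (tgt_right : Z.tgt = Y.tgt)
      (map : ∀ A, Z.map A ∈ D.str.comp j (X.map A) (Y.map A)) :
      IsTransforComp j.succ ⟨C, D, X⟩ ⟨C, D, Y⟩ ⟨C, D, Z⟩

/-- `Z = X + Y`, componentwise; in particular the three have the same boundary `*`-functors. -/
inductive IsTransforAdd {m : ℕ} : Cell.{u} m → Cell.{u} m → Cell.{u} m → Prop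
  | mk {C D : SmallLR.{u} m} (X Y Z : NTransfor C D)
      (src_left : Z.src = X.src) (src_right : Z.src = Y.src)
      (tgt_left : Z.tgt = X.tgt) (tgt_right : Z.tgt = Y.tgt)
      (map : ∀ A, Z.map A ∈ D.str.add (X.map A) (Y.map A)) :
      IsTransforAdd ⟨C, D, X⟩ ⟨C, D, Y⟩ ⟨C, D, Z⟩

/-- `Z = c · X`, componentwise. -/
inductive IsTransforSMul {m : ℕ} (c : ℂ) : Cell.{u} m → Cell.{u} m → Prop
  | mk {C D : SmallLR.{u} m} (X Z : NTransfor C D)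
      (src : Z.src = X.src) (tgt : Z.tgt = X.tgt)
      (map : ∀ A, Z.map A = D.str.smul c (X.map A)) :
      IsTransforSMul c ⟨C, D, X⟩ ⟨C, D, Z⟩

/-- `Z` is the adjoint of `X`, componentwise. For `n = 1` (that is `m = 0`) the two boundary
`*`-functors are exchanged, for `n ≥ 2` they are kept (the two boundary `(n-1)`-transfors are
exchanged, which is encoded in the components). -/
inductive IsTransforStar {m : ℕ} : Cell.{u} m → Cell.{u} m → Prop
  | swap {C D : SmallLR.{u} m} (hm : m = 0) (X Z : NTransfor C D)
      (src : Z.src = X.tgt) (tgt : Z.tgt = X.src)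
      (map : ∀ A, Z.map A = D.str.star (X.map A)) :
      IsTransforStar ⟨C, D, X⟩ ⟨C, D, Z⟩
  | keep {C D : SmallLR.{u} m} (hm : m ≠ 0) (X Z : NTransfor C D)
      (src : Z.src = X.src) (tgt : Z.tgt = X.tgt)
      (map : ∀ A, Z.map A = D.str.star (X.map A)) :
      IsTransforStar ⟨C, D, X⟩ ⟨C, D, Z⟩

/-- The supremum norm of a bounded transfor. -/
noncomputable def Cell.supNorm {m : ℕ} (X : Cell.{u} m) : ℝ :=
  ⨆ A : X.dom.Obj, X.cod.str.norm (X.transfor.map A)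

end HigherCStar

/-! Apart from its two boundary functors, a transfor is a family of cells of the target category,
and all operations except composition over objects are performed component by component. The axioms
are therefore inherited from the target category, once closure, completeness and positivity are
settled.

Closure. The inductive tower of bounding transfors is replaced by one condition, `IsBoundedNat`: the
family is bounded and natural, and so are its componentwise `j`-sources and `j`-targets for `j ≠ 0`.
The boundary families are bounded for free, since the C*-property gives identities norm at most `1`.
Naturality of composites, sums and adjoints follows from associativity, exchange, bilinearity and
compatibility of the involution with composition. Composition over objects also applies a functor to
components; boundedness then rests on `StarFunctor.norm_map_le`, a consequence of contractivity of
`*`-homomorphisms between C*-algebras.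

Globular axioms. Exchange between two compositions over transfors or functors is exchange in the
target. Exchange of `∘₀` with `∘₁` is the interchange law for natural transformations and needs
naturality (`HComp.exchange`).

Completeness. A block of transfors is a subspace of the `ℓ^∞`-sum of the blocks of components.
Composition with a fixed cell is a bounded linear operator, so naturality is a closed linear
condition (`isClosed_naturalFamilies`).

Positivity. All axioms but positivity (`PreLR`) already make the endomorphisms of an `(n-1)`-arrow a
unital C*-algebra. For transfors, the evaluations at objects are jointly faithful `*`-homomorphisms
out of this algebra, and they send `X* ∘ X` to elements that are positive by the axiom in the target
category. Positivity is detected by such a family, because the negative part must vanish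
(`exists_eq_star_mul_self_of_forall`). -/

namespace HigherCStar

/-! ### Sources, targets and composites in globular categories -/

namespace GlobularCategory

variable {n : ℕ} {C : Type u} (G : GlobularCategory n C)

/-- The `∘ₚ`-source of a cell. -/
noncomputable def s (p : Fin n) (x : C) : C := ((G.isCategory p).exists_source x).choose

/-- The `∘ₚ`-target of a cell. -/
noncomputable def t (p : Fin n) (x : C) : C := ((G.isCategory p).exists_target x).choose

lemma isSource_s (p : Fin n) (x : C) : IsSource (G.comp p) x (G.s p x) :=
  ((G.isCategory p).exists_source x).choose_spec

lemma isTarget_t (p : Fin n) (x : C) : IsTarget (G.comp p) x (G.t p x) :=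
  ((G.isCategory p).exists_target x).choose_spec

variable {G} {p q : Fin n} {u v w x x' y z z' e : C}

lemma comp_unique (h : z ∈ G.comp p x y) (h' : z' ∈ G.comp p x y) : z = z' :=
  Part.mem_unique h h'

lemma mem_of_isSource (h : IsSource (G.comp p) x e) : x ∈ G.comp p x e := by
  obtain ⟨k, hk⟩ := Part.dom_iff_mem.1 h.2
  rwa [h.1.1 _ _ hk] at hk

lemma mem_of_isTarget (h : IsTarget (G.comp p) x e) : x ∈ G.comp p e x := by
  obtain ⟨k, hk⟩ := Part.dom_iff_mem.1 h.2
  rwa [h.1.2 _ _ hk] at hk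

lemma comp_s (p : Fin n) (x : C) : x ∈ G.comp p x (G.s p x) := mem_of_isSource (G.isSource_s p x)

lemma t_comp (p : Fin n) (x : C) : x ∈ G.comp p (G.t p x) x := mem_of_isTarget (G.isTarget_t p x)

lemma exists_assoc_right (h : u ∈ G.comp p x y) (h' : w ∈ G.comp p u z) :
    ∃ v, v ∈ G.comp p y z ∧ w ∈ G.comp p x v := by
  have : w ∈ (G.comp p x y).bind fun k => G.comp p k z := Part.mem_bind h h'
  rw [← (G.isCategory p).assoc] at this
  exact Part.mem_bind_iff.1 this

lemma exists_assoc_left (h : v ∈ G.comp p y z) (h' : w ∈ G.comp p x v) :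
    ∃ u, u ∈ G.comp p x y ∧ w ∈ G.comp p u z := by
  have : w ∈ (G.comp p y z).bind fun k => G.comp p x k := Part.mem_bind h h'
  rw [(G.isCategory p).assoc] at this
  exact Part.mem_bind_iff.1 this

lemma assoc_right (h : u ∈ G.comp p x y) (h' : w ∈ G.comp p u z) (hv : v ∈ G.comp p y z) :
    w ∈ G.comp p x v := by
  obtain ⟨v', h1, h2⟩ := exists_assoc_right h h'
  rwa [comp_unique hv h1]

lemma assoc_left (h : v ∈ G.comp p y z) (h' : w ∈ G.comp p x v) (hu : u ∈ G.comp p x y) :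
    w ∈ G.comp p u z := by
  obtain ⟨v', h1, h2⟩ := exists_assoc_left h h'
  rwa [comp_unique hu h1]

/-- Sources are unique: if `x ∘ e` exists, reassociating `(x ∘ s x) ∘ e` shows that the identities
`s x` and `e` are composable, and composable identities coincide. From here on sources and targets
are functions. -/
lemma isSource_iff : IsSource (G.comp p) x e ↔ G.s p x = e := by
  refine ⟨fun h => ?_, fun h => h ▸ G.isSource_s p x⟩
  obtain ⟨v, hv, -⟩ := exists_assoc_right (comp_s p x) (mem_of_isSource h)
  rw [← (G.isSource_s p x).1.2 _ _ hv, h.1.1 _ _ hv] 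

lemma isTarget_iff : IsTarget (G.comp p) x e ↔ G.t p x = e := by
  refine ⟨fun h => ?_, fun h => h ▸ G.isTarget_t p x⟩
  obtain ⟨v, hv, -⟩ := exists_assoc_left (t_comp p x) (mem_of_isTarget h)
  rw [← (G.isTarget_t p x).1.1 _ _ hv, h.1.2 _ _ hv]

lemma isPartialId_s (p : Fin n) (x : C) : IsPartialId (G.comp p) (G.s p x) := (G.isSource_s p x).1

lemma isPartialId_t (p : Fin n) (x : C) : IsPartialId (G.comp p) (G.t p x) := (G.isTarget_t p x).1

lemma isPartialId_iff : IsPartialId (G.comp p) e ↔ G.s p e = e :=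
  ⟨fun h => (h.2 _ _ (comp_s p e)).symm, fun h => h ▸ isPartialId_s p e⟩

lemma isPartialId_iff_t : IsPartialId (G.comp p) e ↔ G.t p e = e :=
  ⟨fun h => (h.1 _ _ (t_comp p e)).symm, fun h => h ▸ isPartialId_t p e⟩

@[simp] lemma s_s (p : Fin n) (x : C) : G.s p (G.s p x) = G.s p x :=
  isPartialId_iff.1 (isPartialId_s p x)

@[simp] lemma s_t (p : Fin n) (x : C) : G.s p (G.t p x) = G.t p x :=
  isPartialId_iff.1 (isPartialId_t p x)

@[simp] lemma t_s (p : Fin n) (x : C) : G.t p (G.s p x) = G.s p x :=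
  isPartialId_iff_t.1 (isPartialId_s p x)

@[simp] lemma t_t (p : Fin n) (x : C) : G.t p (G.t p x) = G.t p x :=
  isPartialId_iff_t.1 (isPartialId_t p x)

lemma id_comp_self (h : IsPartialId (G.comp p) e) : e ∈ G.comp p e e := by
  have := comp_s (G := G) p e
  rwa [isPartialId_iff.1 h] at this

/-- Since `x = x ∘ s x`, associativity makes `s x ∘ y` exist, so `s x` is the target of `y`. With
`exists_comp`, composability becomes an equation. -/
lemma match_of_comp (h : z ∈ G.comp p x y) : G.s p x = G.t p y := by
  obtain ⟨v, hv, -⟩ := exists_assoc_right (comp_s p x) h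
  exact (isTarget_iff.1 ⟨isPartialId_s p x, Part.dom_iff_mem.2 ⟨v, hv⟩⟩).symm

lemma exists_comp (h : G.s p x = G.t p y) : ∃ z, z ∈ G.comp p x y :=
  Part.dom_iff_mem.1 ((G.isCategory p).dom_of_match x y _ (G.isSource_s p x)
    (isTarget_iff.2 h.symm))

lemma s_comp (h : z ∈ G.comp p x y) : G.s p z = G.s p y := by
  obtain ⟨u, hu, hz⟩ := exists_assoc_left (comp_s p y) h
  rw [← comp_unique h hu] at hz
  simpa using match_of_comp hz

lemma t_of_comp (h : z ∈ G.comp p x y) : G.t p z = G.t p x := by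
  obtain ⟨u, hu, hz⟩ := exists_assoc_right (t_comp p x) h
  rw [← comp_unique h hu] at hz
  simpa using (match_of_comp hz).symm

/-! ### Globularity: sources and targets at two different levels. -/

lemma s_s_of_lt (h : q < p) (x : C) : G.s p (G.s q x) = G.s q x :=
  isPartialId_iff.1 (G.id_mono _ _ h _ (isPartialId_s q x))

lemma s_t_of_lt (h : q < p) (x : C) : G.s p (G.t q x) = G.t q x :=
  isPartialId_iff.1 (G.id_mono _ _ h _ (isPartialId_t q x))

lemma t_s_of_lt (h : q < p) (x : C) : G.t p (G.s q x) = G.s q x :=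
  isPartialId_iff_t.1 (G.id_mono _ _ h _ (isPartialId_s q x))

lemma t_t_of_lt (h : q < p) (x : C) : G.t p (G.t q x) = G.t q x :=
  isPartialId_iff_t.1 (G.id_mono _ _ h _ (isPartialId_t q x))

/-- The `q`-source is also a `p`-identity, so `x ∘_q s_q x` can be written `(x ∘ₚ sₚ x) ∘_q (s_q x
∘ₚ s_q x)`. Exchange then makes `sₚ x ∘_q s_q x` exist. The three variants below are the same
argument. -/
lemma s_s_of_gt (h : q < p) (x : C) : G.s q (G.s p x) = G.s q x := by
  obtain ⟨d, e, -, he, -⟩ := G.exchange q p h _ _ _ _ _ _ _ (comp_s p x)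
    (id_comp_self (G.id_mono _ _ h _ (isPartialId_s q x))) (comp_s q x)
  simpa using match_of_comp he

lemma s_t_of_gt (h : q < p) (x : C) : G.s q (G.t p x) = G.s q x := by
  obtain ⟨d, e, hd, -, -⟩ := G.exchange q p h _ _ _ _ _ _ _ (t_comp p x)
    (id_comp_self (G.id_mono _ _ h _ (isPartialId_s q x))) (comp_s q x)
  simpa using match_of_comp hd

lemma t_s_of_gt (h : q < p) (x : C) : G.t q (G.s p x) = G.t q x := by
  obtain ⟨d, e, -, he, -⟩ := G.exchange q p h _ _ _ _ _ _ _
    (id_comp_self (G.id_mono _ _ h _ (isPartialId_t q x))) (comp_s p x) (t_comp q x)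
  simpa using (match_of_comp he).symm

lemma t_t_of_gt (h : q < p) (x : C) : G.t q (G.t p x) = G.t q x := by
  obtain ⟨d, e, hd, -, -⟩ := G.exchange q p h _ _ _ _ _ _ _
    (id_comp_self (G.id_mono _ _ h _ (isPartialId_t q x))) (t_comp p x) (t_comp q x)
  simpa using (match_of_comp hd).symm

/-- Exchange applied to `(x ∘ₚ sₚ x) ∘_q (y ∘ₚ sₚ y)` gives `z = z ∘ₚ e` with `e = sₚ x ∘_q sₚ y`;
this `e` is a `p`-identity by `id_comp_id`, hence equals `sₚ z`. -/
lemma s_comp_of_gt (h : q < p) (hz : z ∈ G.comp q x y) :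
    G.s p z ∈ G.comp q (G.s p x) (G.s p y) := by
  obtain ⟨d, e, hd, he, hde⟩ := G.exchange q p h _ _ _ _ _ _ _ (comp_s p x) (comp_s p y) hz
  rw [← comp_unique hz hd] at hde
  have := G.id_comp_id q p h _ _ _ (isPartialId_s p x) (isPartialId_s p y) he
  rwa [match_of_comp hde, isPartialId_iff_t.1 this]

lemma t_comp_of_gt (h : q < p) (hz : z ∈ G.comp q x y) :
    G.t p z ∈ G.comp q (G.t p x) (G.t p y) := by
  obtain ⟨d, e, hd, he, hde⟩ := G.exchange q p h _ _ _ _ _ _ _ (t_comp p x) (t_comp p y) hz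
  rw [← comp_unique hz he] at hde
  have := G.id_comp_id q p h _ _ _ (isPartialId_t p x) (isPartialId_t p y) hd
  rwa [← match_of_comp hde, isPartialId_iff.1 this]

lemma s_comp_of_lt (h : q < p) (hz : z ∈ G.comp p x y) : G.s q z = G.s q y := by
  rw [← s_s_of_gt h, s_comp hz, s_s_of_gt h]

lemma t_of_comp_of_lt (h : q < p) (hz : z ∈ G.comp p x y) : G.t q z = G.t q x := by
  rw [← t_t_of_gt h, t_of_comp hz, t_t_of_gt h]

lemma comp_congr (h : z ∈ G.comp p x y) (h' : z ∈ G.comp q u v) :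
    G.comp p x y = G.comp q u v :=
  (Part.eq_some_iff.2 h).trans (Part.eq_some_iff.2 h').symm

/-! ### Blocks and parallel arrows. -/

lemma mem_block_iff {m : ℕ} {G : GlobularCategory (m + 1) C} {a b : C} :
    x ∈ G.block a b ↔ G.t (Fin.last m) x = a ∧ G.s (Fin.last m) x = b := by
  simp [block, isSource_iff, isTarget_iff]

lemma mem_level_iff {k : ℕ} :
    x ∈ G.level k ↔ ∀ h : k < n, G.s ⟨k, h⟩ x = x := by
  simp [level, isPartialId_iff]

lemma parallel_iff {m : ℕ} {G : GlobularCategory (m + 1) C} {a b : C} :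
    G.Parallel a b ↔ G.s (Fin.last m) a = a ∧ G.s (Fin.last m) b = b ∧ ∀ p < Fin.last m,
      G.s p a = G.s p b ∧ G.t p a = G.t p b := by
  have hl : ∀ x, x ∈ G.level m ↔ G.s (Fin.last m) x = x := fun x => by
    rw [mem_level_iff]; exact ⟨fun h => h (Nat.lt_succ_self m), fun h _ => h⟩
  simp only [Parallel, hl, isSource_iff, isTarget_iff]
  refine and_congr_right fun _ => and_congr_right fun _ => forall₂_congr fun p _ => ?_
  refine and_congr ⟨fun h => ((h _).2 rfl), fun h e => by rw [h]⟩
    ⟨fun h => ((h _).2 rfl), fun h e => by rw [h]⟩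

lemma parallel_of_mem_block {m : ℕ} {G : GlobularCategory (m + 1) C} {a b : C}
    (h : x ∈ G.block a b) : G.Parallel a b := by
  obtain ⟨rfl, rfl⟩ := mem_block_iff.1 h
  refine parallel_iff.2 ⟨s_t _ _, s_s _ _, fun p hp => ⟨?_, ?_⟩⟩
  · rw [s_t_of_gt hp, s_s_of_gt hp]
  · rw [t_t_of_gt hp, t_s_of_gt hp]

lemma mem_block_self {m : ℕ} (G : GlobularCategory (m + 1) C) (x : C) :
    x ∈ G.block (G.t (Fin.last m) x) (G.s (Fin.last m) x) := mem_block_iff.2 ⟨rfl, rfl⟩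

lemma parallel_self {m : ℕ} {G : GlobularCategory (m + 1) C}
    (h : G.s (Fin.last m) x = x) : G.Parallel x x :=
  parallel_iff.2 ⟨h, h, fun _ _ => ⟨rfl, rfl⟩⟩

lemma s_eq_of_mem_block {m : ℕ} {G : GlobularCategory (m + 1) C} {a b : C}
    (h : x ∈ G.block a b) (h' : y ∈ G.block a b) (p : Fin (m + 1)) :
    G.s p x = G.s p y := by
  obtain ⟨-, hx⟩ := mem_block_iff.1 h
  obtain ⟨-, hy⟩ := mem_block_iff.1 h'
  rcases (Fin.le_last p).eq_or_lt with rfl | hp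
  · rw [hx, hy]
  · rw [← s_s_of_gt hp x, ← s_s_of_gt hp y, hx, hy]

lemma t_eq_of_mem_block {m : ℕ} {G : GlobularCategory (m + 1) C} {a b : C}
    (h : x ∈ G.block a b) (h' : y ∈ G.block a b) (p : Fin (m + 1)) :
    G.t p x = G.t p y := by
  obtain ⟨hx, -⟩ := mem_block_iff.1 h
  obtain ⟨hy, -⟩ := mem_block_iff.1 h'
  rcases (Fin.le_last p).eq_or_lt with rfl | hp
  · rw [hx, hy]
  · rw [← t_t_of_gt hp x, ← t_t_of_gt hp y, hx, hy]

lemma s_of_mem_block {m : ℕ} {G : GlobularCategory (m + 1) C} {a b : C}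
    (h : x ∈ G.block a b) (p : Fin (m + 1)) : G.s p x = G.s p b := by
  obtain ⟨-, hx⟩ := mem_block_iff.1 h
  rcases (Fin.le_last p).eq_or_lt with rfl | hp
  · rw [← hx, s_s]
  · rw [← hx, s_s_of_gt hp]

lemma t_of_mem_block {m : ℕ} {G : GlobularCategory (m + 1) C} {a b : C}
    (h : x ∈ G.block a b) (p : Fin (m + 1)) : G.t p x = G.t p a := by
  obtain ⟨hx, -⟩ := mem_block_iff.1 h
  rcases (Fin.le_last p).eq_or_lt with rfl | hp
  · rw [← hx, t_t]
  · rw [← hx, t_t_of_gt hp]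

/-! ### Globular categories given by composition relations -/

/-- A globular category given by the graphs of its compositions together with source and
target maps. -/
noncomputable def ofRel (R : Fin n → C → C → C → Prop) (s t : Fin n → C → C)
    (unique : ∀ p x y z z', R p x y z → R p x y z' → z = z')
    (ex : ∀ p x y, s p x = t p y → ∃ z, R p x y z)
    (mat : ∀ p x y z, R p x y z → s p x = t p y)
    (hs : ∀ p x y z, R p x y z → s p z = s p y)
    (ht : ∀ p x y z, R p x y z → t p z = t p x)
    (id_right : ∀ p x, R p x (s p x) x)
    (id_left : ∀ p x, R p (t p x) x x)
    (assoc : ∀ p x y z u v w, R p x y u → R p y z v → R p u z w → R p x v w)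
    (mono : ∀ q p, q < p → ∀ x, s p (s q x) = s q x)
    (hsR : ∀ q p, q < p → ∀ x y z, R q x y z → R q (s p x) (s p y) (s p z))
    (exch : ∀ q p, q < p → ∀ x y w z a b c, R p x y a → R p w z b → R q a b c →
      ∃ d e, R q x w d ∧ R q y z e ∧ R p d e c) : GlobularCategory n C :=
  -- The value of the composite is chosen; uniqueness makes the choice irrelevant.
  have mem : ∀ p x y z, z ∈ (⟨∃ z, R p x y z, fun h => h.choose⟩ : Part C) ↔ R p x y z :=
    fun p x y z => ⟨by rintro ⟨h, rfl⟩; exact h.choose_spec,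
      fun h => ⟨⟨z, h⟩, unique _ _ _ _ _ (Exists.choose_spec (⟨z, h⟩ : ∃ z, R p x y z)) h⟩⟩
  have pid : ∀ p e, IsPartialId (fun x y => (⟨∃ z, R p x y z, fun h => h.choose⟩ : Part C)) e ↔
      s p e = e := by
    intro p e
    refine ⟨fun h => (h.2 _ _ ((mem _ _ _ _).2 (id_right p e))).symm,
      fun h => ⟨fun x k hk => ?_, fun x k hk => ?_⟩⟩
    · have h1 := (mem _ _ _ _).1 hk
      have h2 := mat _ _ _ _ h1
      have h3 := mat _ _ _ _ (id_right p e)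
      rw [h] at h3
      have h4 := id_right p x
      rw [h2, ← h3] at h4
      exact unique _ _ _ _ _ h1 h4
    · have h1 := (mem _ _ _ _).1 hk
      have h2 := mat _ _ _ _ h1
      have h4 := id_left p x
      rw [← h2, h] at h4
      exact unique _ _ _ _ _ h1 h4
  have ss : ∀ p x, s p (s p x) = s p x := fun p x => (hs _ _ _ _ (id_right p x)).symm
  have st : ∀ p x, s p (t p x) = t p x := fun p x => mat _ _ _ _ (id_left p x)
  have src : ∀ p x e, IsSource (fun x y => (⟨∃ z, R p x y z, fun h => h.choose⟩ : Part C)) x e ↔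
      s p x = e := by
    intro p x e
    refine ⟨fun ⟨h, z, hz⟩ => ?_, ?_⟩
    · have h3 := mat _ _ _ _ (id_right p e)
      rw [(pid _ _).1 h] at h3
      rw [mat _ _ _ _ hz, ← h3]
    · rintro rfl
      exact ⟨(pid _ _).2 (ss p x), _, id_right p x⟩
  have tgt : ∀ p x e, IsTarget (fun x y => (⟨∃ z, R p x y z, fun h => h.choose⟩ : Part C)) x e ↔
      t p x = e := by
    intro p x e
    refine ⟨fun ⟨h, z, hz⟩ => ?_, ?_⟩
    · rw [← mat _ _ _ _ hz, (pid _ _).1 h]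
    · rintro rfl
      exact ⟨(pid _ _).2 (st p x), _, id_left p x⟩
  { comp := fun p x y => ⟨∃ z, R p x y z, fun h => h.choose⟩
    isCategory := fun p =>
      { assoc := by
          intro f g h
          ext w
          simp only [Part.mem_bind_iff, mem]
          constructor
          -- Only one direction of associativity is assumed. For this one, the composite bracketed
          -- to the left exists because sources and targets match, and by uniqueness its value is
          -- the given one.
          · rintro ⟨v, hv, hw⟩
            have h1 : s p f = t p g := by rw [mat _ _ _ _ hw, ht _ _ _ _ hv]
            obtain ⟨u, hu⟩ := ex _ _ _ h1
            obtain ⟨w', hw'⟩ := ex p u h (by rw [hs _ _ _ _ hu, mat _ _ _ _ hv])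
            have := assoc _ _ _ _ _ _ _ hu hv hw'
            rw [unique _ _ _ _ _ hw this]
            exact ⟨u, hu, hw'⟩
          · rintro ⟨u, hu, hw⟩
            obtain ⟨v, hv⟩ := ex p g h (by rw [← hs _ _ _ _ hu, mat _ _ _ _ hw])
            exact ⟨v, hv, assoc _ _ _ _ _ _ _ hu hv hw⟩
        exists_source := fun f => ⟨_, (src _ _ _).2 rfl⟩
        exists_target := fun f => ⟨_, (tgt _ _ _).2 rfl⟩
        dom_of_match := fun f g e hf hg =>
          ex _ _ _ (((src _ _ _).1 hf).trans ((tgt _ _ _).1 hg).symm) }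
    id_mono := fun q p h e he => by
      rw [pid] at he ⊢
      rw [← he, mono _ _ h]
    id_comp_id := fun q p h e f g he hf hg => by
      rw [pid] at he hf ⊢
      rw [mem] at hg
      -- As `e` and `f` are their own `p`-sources, `s p g` is also a value of `e ∘_q f`, so it
      -- equals `g`.
      have := hsR _ _ h _ _ _ hg
      rw [he, hf] at this
      exact unique _ _ _ _ _ this hg
    exchange := by
      simp only [mem]
      exact exch }

section ofRel

variable {R : Fin n → C → C → C → Prop} {s' t' : Fin n → C → C} {unique ex mat hs ht id_right id_left
  assoc mono hsR exch}

lemma mem_ofRel_comp : z ∈ (ofRel R s' t' unique ex mat hs ht id_right id_left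
    assoc mono hsR exch).comp p x y ↔ R p x y z :=
  ⟨by rintro ⟨h, rfl⟩; exact h.choose_spec,
    fun h => ⟨⟨z, h⟩, unique _ _ _ _ _ (Exists.choose_spec (⟨z, h⟩ : ∃ z, R p x y z)) h⟩⟩

/-- The source in the constructed category is chosen abstractly and has to be matched with the
prescribed one: `t (s' x)` and `s' x` are both values of the composite `t (s' x) ∘ s' x`. -/
lemma ofRel_s (p : Fin n) (x : C) : (ofRel R s' t' unique ex mat hs ht id_right id_left
    assoc mono hsR exch).s p x = s' p x := by
  set G := ofRel R s' t' unique ex mat hs ht id_right id_left assoc mono hsR exch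
  have h1 : G.s p x = G.t p (s' p x) := match_of_comp (mem_ofRel_comp.2 (id_right p x))
  have h2 : R p (G.t p (s' p x)) (s' p x) (s' p x) := mem_ofRel_comp.1 (t_comp p (s' p x))
  have h3 := id_right p (G.t p (s' p x))
  rw [mat _ _ _ _ h2, ← mat _ _ _ _ (id_right p x)] at h3
  exact h1.trans (unique _ _ _ _ _ h3 h2)

lemma ofRel_t (p : Fin n) (x : C) : (ofRel R s' t' unique ex mat hs ht id_right id_left
    assoc mono hsR exch).t p x = t' p x := by
  set G := ofRel R s' t' unique ex mat hs ht id_right id_left assoc mono hsR exch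
  have h1 : G.s p (t' p x) = G.t p x := match_of_comp (mem_ofRel_comp.2 (id_left p x))
  have h2 : R p (t' p x) (G.s p (t' p x)) (t' p x) := mem_ofRel_comp.1 (comp_s p (t' p x))
  have h3 := id_left p (G.s p (t' p x))
  rw [← mat _ _ _ _ h2, mat _ _ _ _ (id_left p x)] at h3
  exact h1.symm.trans (unique _ _ _ _ _ h3 h2)

end ofRel

end GlobularCategory

end HigherCStar

namespace HigherCStar

/-! ### The linear and involutive structure without positivity -/

/-- The structure of an `LRStructure` except for the positivity of `x* ∘ₙ₋₁ x`. -/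
structure PreLR (m : ℕ) (C : Type u) extends GlobularCategory (m + 1) C where
  star : C → C
  add : C → C → Part C
  smul : ℂ → C → C
  norm : C → ℝ
  /-- Addition is defined exactly inside the blocks. -/
  add_dom : ∀ x y, (add x y).Dom ↔
    ∃ a b, x ∈ toGlobularCategory.block a b ∧ y ∈ toGlobularCategory.block a b
  /-- The block of two `(n-1)`-arrows in globular position is a complex Banach space. -/
  banach : ∀ a b, toGlobularCategory.Parallel a b →
    ∃ (_ : NormedAddCommGroup (toGlobularCategory.block a b))
      (_ : NormedSpace ℂ (toGlobularCategory.block a b)),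
      CompleteSpace (toGlobularCategory.block a b) ∧
      (∀ x y : toGlobularCategory.block a b,
        ((x + y : toGlobularCategory.block a b) : C) ∈ add x y) ∧
      (∀ (c : ℂ) (x : toGlobularCategory.block a b),
        ((c • x : toGlobularCategory.block a b) : C) = smul c x) ∧
      (∀ x : toGlobularCategory.block a b, ‖x‖ = norm x)
  /-- Every composition `∘ₚ` is bilinear on composable blocks (four conditions). -/
  add_comp : ∀ p x x' y u a b, u ∈ add x x' → a ∈ comp p x y → b ∈ comp p x' y →
    ∃ v, v ∈ comp p u y ∧ v ∈ add a b
  comp_add : ∀ p x y y' u a b, u ∈ add y y' → a ∈ comp p x y → b ∈ comp p x y' →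
    ∃ v, v ∈ comp p x u ∧ v ∈ add a b
  smul_comp : ∀ p c x y z, z ∈ comp p x y → smul c z ∈ comp p (smul c x) y
  comp_smul : ∀ p c x y z, z ∈ comp p x y → smul c z ∈ comp p x (smul c y)
  /-- Every composition `∘ₚ` is norm submultiplicative. -/
  norm_comp_le : ∀ p x y z, z ∈ comp p x y → norm z ≤ norm x * norm y
  star_star : ∀ x, star (star x) = x
  /-- The involution is trivial on `(n-1)`-arrows. -/
  star_id : ∀ e, IsPartialId (comp (Fin.last m)) e → star e = e
  /-- The involution is conjugate-linear on blocks. -/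
  star_add : ∀ x y z, z ∈ add x y → star z ∈ add (star x) (star y)
  star_smul : ∀ (c : ℂ) x, star (smul c x) = smul (starRingEnd ℂ c) (star x)
  /-- The involution is contravariant for `∘ₙ₋₁`. -/
  star_comp_top : ∀ x y z, z ∈ comp (Fin.last m) x y → star z ∈ comp (Fin.last m) (star y) (star x)
  /-- The involution is covariant for `∘ₖ`, `k < n - 1`. -/
  star_comp : ∀ k < Fin.last m, ∀ x y z, z ∈ comp k x y → star z ∈ comp k (star x) (star y)
  /-- The C*-property. -/
  norm_star_comp_self : ∀ x z, z ∈ comp (Fin.last m) (star x) x → norm z = norm x ^ 2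

/-- Forget the positivity axiom. -/
abbrev LRStructure.pre {m : ℕ} {C : Type u} (L : LRStructure m C) : PreLR m C where
  toGlobularCategory := L.toGlobularCategory
  star := L.star
  add := L.add
  smul := L.smul
  norm := L.norm
  add_dom := L.add_dom
  banach := L.banach
  add_comp := L.add_comp
  comp_add := L.comp_add
  smul_comp := L.smul_comp
  comp_smul := L.comp_smul
  norm_comp_le := L.norm_comp_le
  star_star := L.star_star
  star_id := L.star_id
  star_add := L.star_add
  star_smul := L.star_smul
  star_comp_top := L.star_comp_top
  star_comp := L.star_comp
  norm_star_comp_self := L.norm_star_comp_self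

end HigherCStar

namespace HigherCStar

namespace PreLR

open GlobularCategory

variable {m : ℕ} {C : Type u} {P : PreLR m C} {a b e x y z u w w' : C} {p : Fin (m + 1)}

/-! ### Blocks as Banach spaces -/

/-- The block between two `(n-1)`-arrows in globular position, as a Banach space. -/
def Blk (P : PreLR m C) {a b : C} (_ : P.Parallel a b) : Type u := P.block a b

/-- An element of a block. -/
def Blk.mk (h : P.Parallel a b) (x : C) (hx : x ∈ P.block a b) : P.Blk h := ⟨x, hx⟩

namespace Blk

variable {h : P.Parallel a b}

@[ext] lemma ext {x y : P.Blk h} (hxy : x.1 = y.1) : x = y := Subtype.ext hxy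

noncomputable instance : NormedAddCommGroup (P.Blk h) := (P.banach a b h).choose

noncomputable instance : NormedSpace ℂ (P.Blk h) := (P.banach a b h).choose_spec.choose

instance : CompleteSpace (P.Blk h) := (P.banach a b h).choose_spec.choose_spec.1

lemma add_mem (x y : P.Blk h) : (x + y).1 ∈ P.add x.1 y.1 :=
  (P.banach a b h).choose_spec.choose_spec.2.1 x y

lemma coe_smul (c : ℂ) (x : P.Blk h) : (c • x).1 = P.smul c x.1 :=
  (P.banach a b h).choose_spec.choose_spec.2.2.1 c x

lemma norm_def (x : P.Blk h) : ‖x‖ = P.norm x.1 :=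
  (P.banach a b h).choose_spec.choose_spec.2.2.2 x

lemma eq_add {x y z : P.Blk h} (hz : z.1 ∈ P.add x.1 y.1) : z = x + y :=
  ext (Part.mem_unique hz (add_mem x y))

end Blk

/-- A cell as an element of its block. -/
def toBlk (P : PreLR m C) (x : C) : P.Blk (parallel_of_mem_block (mem_block_self P.1 x)) :=
  ⟨x, mem_block_self P.1 x⟩

/-! ### Linear operations and norm on arbitrary cells, each placed in the block of its own target
and source. -/

lemma norm_nonneg (P : PreLR m C) (x : C) : 0 ≤ P.norm x :=
  (Blk.norm_def (P.toBlk x)) ▸ _root_.norm_nonneg _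

lemma smul_mem_block (c : ℂ) (h : x ∈ P.block a b) : P.smul c x ∈ P.block a b := by
  have := (c • Blk.mk (parallel_of_mem_block h) x h).2
  rwa [Blk.coe_smul] at this

lemma exists_add (hx : x ∈ P.block a b) (hy : y ∈ P.block a b) :
    ∃ z ∈ P.block a b, z ∈ P.add x y :=
  ⟨_, Subtype.property _, Blk.add_mem (Blk.mk (parallel_of_mem_block hx) x hx) (Blk.mk _ y hy)⟩

lemma blocks_of_add (h : z ∈ P.add x y) :
    ∃ a b, x ∈ P.block a b ∧ y ∈ P.block a b ∧ z ∈ P.block a b := by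
  obtain ⟨a, b, hx, hy⟩ := (P.add_dom x y).1 (Part.dom_iff_mem.2 ⟨z, h⟩)
  obtain ⟨z', hz', hz⟩ := exists_add hx hy
  exact ⟨a, b, hx, hy, Part.mem_unique h hz ▸ hz'⟩

lemma s_add (p : Fin (m + 1)) (h : z ∈ P.add x y) : P.s p z = P.s p x := by
  obtain ⟨a, b, hx, hy, hz⟩ := blocks_of_add h
  exact s_eq_of_mem_block hz hx p

lemma t_add (p : Fin (m + 1)) (h : z ∈ P.add x y) : P.t p z = P.t p x := by
  obtain ⟨a, b, hx, hy, hz⟩ := blocks_of_add h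
  exact t_eq_of_mem_block hz hx p

lemma s_eq_of_add (p : Fin (m + 1)) (h : z ∈ P.add x y) : P.s p x = P.s p y := by
  obtain ⟨a, b, hx, hy, hz⟩ := blocks_of_add h
  exact s_eq_of_mem_block hx hy p

lemma t_eq_of_add (p : Fin (m + 1)) (h : z ∈ P.add x y) : P.t p x = P.t p y := by
  obtain ⟨a, b, hx, hy, hz⟩ := blocks_of_add h
  exact t_eq_of_mem_block hx hy p

@[simp] lemma s_smul (p : Fin (m + 1)) (c : ℂ) (x : C) : P.s p (P.smul c x) = P.s p x :=
  s_eq_of_mem_block (smul_mem_block c (mem_block_self P.1 x)) (mem_block_self P.1 x) p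

@[simp] lemma t_smul (p : Fin (m + 1)) (c : ℂ) (x : C) : P.t p (P.smul c x) = P.t p x :=
  t_eq_of_mem_block (smul_mem_block c (mem_block_self P.1 x)) (mem_block_self P.1 x) p

lemma norm_smul (P : PreLR m C) (c : ℂ) (x : C) : P.norm (P.smul c x) = ‖c‖ * P.norm x := by
  have := _root_.norm_smul c (P.toBlk x)
  rwa [Blk.norm_def, Blk.norm_def, Blk.coe_smul] at this

lemma norm_add_le (h : z ∈ P.add x y) : P.norm z ≤ P.norm x + P.norm y := by
  obtain ⟨a, b, hx, hy, hz⟩ := blocks_of_add h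
  have hp := parallel_of_mem_block hx
  have := _root_.norm_add_le (Blk.mk hp x hx) (Blk.mk hp y hy)
  rwa [← Blk.eq_add (z := Blk.mk hp z hz) h, Blk.norm_def, Blk.norm_def, Blk.norm_def] at this

/-! ### The involution -/

lemma star_comp_last (x : C) : P.star x ∈ P.comp (Fin.last m) (P.s (Fin.last m) x) (P.star x) := by
  have := P.star_comp_top _ _ _ (comp_s (G := P.1) _ x)
  rwa [P.star_id _ (isPartialId_s _ x)] at this

lemma t_last_star (x : C) : P.t (Fin.last m) (P.star x) = P.s (Fin.last m) x := by
  have := match_of_comp (star_comp_last (P := P) x)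
  rw [← this, s_s]

lemma s_last_star (x : C) : P.s (Fin.last m) (P.star x) = P.t (Fin.last m) x := by
  rw [← t_last_star (P := P), P.star_star]

lemma star_s_of_lt (hp : p < Fin.last m) (x : C) : P.star (P.s p x) = P.s p x :=
  P.star_id _ (P.id_mono _ _ hp _ (isPartialId_s p x))

lemma star_t_of_lt (hp : p < Fin.last m) (x : C) : P.star (P.t p x) = P.t p x :=
  P.star_id _ (P.id_mono _ _ hp _ (isPartialId_t p x))

lemma s_star_of_lt (hp : p < Fin.last m) (x : C) : P.s p (P.star x) = P.s p x := by
  have := P.star_comp _ hp _ _ _ (comp_s (G := P.1) p x)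
  rw [star_s_of_lt hp] at this
  rw [match_of_comp this, t_s]

lemma t_star_of_lt (hp : p < Fin.last m) (x : C) : P.t p (P.star x) = P.t p x := by
  have := P.star_comp _ hp _ _ _ (t_comp (G := P.1) p x)
  rw [star_t_of_lt hp] at this
  rw [← match_of_comp this, s_t]

lemma exists_star_comp_self (P : PreLR m C) (x : C) :
    ∃ z, z ∈ P.comp (Fin.last m) (P.star x) x :=
  exists_comp (s_last_star x)

/-- The C*-property and submultiplicativity give `‖x‖² = ‖x* x‖ ≤ ‖x*‖ ‖x‖`; cancel `‖x‖` when it is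
nonzero. -/
lemma norm_le_norm_star (P : PreLR m C) (x : C) : P.norm x ≤ P.norm (P.star x) := by
  obtain ⟨z, hz⟩ := P.exists_star_comp_self x
  have h1 := P.norm_star_comp_self _ _ hz
  have h2 := P.norm_comp_le _ _ _ _ hz
  rw [h1, sq] at h2
  rcases (P.norm_nonneg x).eq_or_lt with h | h
  · rw [← h]; exact P.norm_nonneg _
  · exact le_of_mul_le_mul_right h2 h

lemma norm_star (P : PreLR m C) (x : C) : P.norm (P.star x) = P.norm x :=
  le_antisymm (by simpa [P.star_star] using P.norm_le_norm_star (P.star x))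
    (P.norm_le_norm_star x)

/-- An identity satisfies `e = e* ∘ e`, so `‖e‖ = ‖e‖²`. The value `0` is not excluded. This bound
makes all lower boundaries of a transfor automatically bounded. -/
lemma norm_id_le_one (h : P.s (Fin.last m) e = e) : P.norm e ≤ 1 := by
  have he := isPartialId_iff.2 h
  have h1 := P.norm_star_comp_self e e (by rw [P.star_id e he]; exact id_comp_self he)
  nlinarith [P.norm_nonneg e]

/-! ### Composition with a fixed cell as a bounded operator -/

/-- Composition on the left with a fixed cell. -/
noncomputable def compLeft {a' b' : C} (p : Fin (m + 1)) (u : C) (h : P.Parallel a b)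
    (h' : P.Parallel a' b') (H : ∀ y ∈ P.block a b, ∃ w ∈ P.block a' b', w ∈ P.comp p u y) :
    P.Blk h →L[ℂ] P.Blk h' :=
  have key : ∀ y : P.Blk h, (H y.1 y.2).choose ∈ P.comp p u y.1 :=
    fun y => (H y.1 y.2).choose_spec.2
  LinearMap.mkContinuous
    { toFun := fun y => Blk.mk h' (H y.1 y.2).choose (H y.1 y.2).choose_spec.1
      map_add' := fun y y' => by
        obtain ⟨v, hv, hv'⟩ := P.comp_add p u _ _ _ _ _ (Blk.add_mem y y') (key y) (key y')
        refine Blk.eq_add ?_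
        rwa [comp_unique hv (key (y + y'))] at hv'
      map_smul' := fun c y => by
        have := P.comp_smul p c _ _ _ (key y)
        rw [← Blk.coe_smul] at this
        exact Blk.ext ((comp_unique (key (c • y)) this).trans
          (Blk.coe_smul c (Blk.mk h' _ (H y.1 y.2).choose_spec.1)).symm) }
    (P.norm u) fun y => by
      rw [Blk.norm_def, Blk.norm_def]
      exact P.norm_comp_le _ _ _ _ (key y)

lemma compLeft_mem {a' b' : C} {h : P.Parallel a b} {h' : P.Parallel a' b'}
    (H : ∀ y ∈ P.block a b, ∃ w ∈ P.block a' b', w ∈ P.comp p u y) (y : P.Blk h) :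
    (compLeft p u h h' H y).1 ∈ P.comp p u y.1 := (H y.1 y.2).choose_spec.2

/-- Composition on the right with a fixed cell. -/
noncomputable def compRight {a' b' : C} (p : Fin (m + 1)) (u : C) (h : P.Parallel a b)
    (h' : P.Parallel a' b') (H : ∀ y ∈ P.block a b, ∃ w ∈ P.block a' b', w ∈ P.comp p y u) :
    P.Blk h →L[ℂ] P.Blk h' :=
  have key : ∀ y : P.Blk h, (H y.1 y.2).choose ∈ P.comp p y.1 u :=
    fun y => (H y.1 y.2).choose_spec.2
  LinearMap.mkContinuous
    { toFun := fun y => Blk.mk h' (H y.1 y.2).choose (H y.1 y.2).choose_spec.1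
      map_add' := fun y y' => by
        obtain ⟨v, hv, hv'⟩ := P.add_comp p _ _ u _ _ _ (Blk.add_mem y y') (key y) (key y')
        refine Blk.eq_add ?_
        rwa [comp_unique hv (key (y + y'))] at hv'
      map_smul' := fun c y => by
        have := P.smul_comp p c _ _ _ (key y)
        rw [← Blk.coe_smul] at this
        exact Blk.ext ((comp_unique (key (c • y)) this).trans
          (Blk.coe_smul c (Blk.mk h' _ (H y.1 y.2).choose_spec.1)).symm) }
    (P.norm u) fun y => by
      rw [Blk.norm_def, Blk.norm_def, mul_comm]
      exact P.norm_comp_le _ _ _ _ (key y)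

lemma compRight_mem {a' b' : C} {h : P.Parallel a b} {h' : P.Parallel a' b'}
    (H : ∀ y ∈ P.block a b, ∃ w ∈ P.block a' b', w ∈ P.comp p y u) (y : P.Blk h) :
    (compRight p u h h' H y).1 ∈ P.comp p y.1 u := (H y.1 y.2).choose_spec.2

/-! ### Endomorphism blocks as C*-algebras -/

section End

variable {h : P.Parallel e e}

lemma s_last_of_parallel (h : P.Parallel a b) : P.s (Fin.last m) a = a := (parallel_iff.1 h).1

lemma t_last_of_parallel (h : P.Parallel a b) : P.t (Fin.last m) a = a :=
  isPartialId_iff_t.1 (isPartialId_iff.2 (s_last_of_parallel h))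

lemma exists_comp_of_mem_block (hx : x ∈ P.block e e) (hy : y ∈ P.block e e) :
    ∃ z ∈ P.block e e, z ∈ P.comp (Fin.last m) x y := by
  obtain ⟨hx1, hx2⟩ := mem_block_iff.1 hx
  obtain ⟨hy1, hy2⟩ := mem_block_iff.1 hy
  obtain ⟨z, hz⟩ := exists_comp (hx2.trans hy1.symm)
  exact ⟨z, mem_block_iff.2 ⟨(t_of_comp hz).trans hx1, (s_comp hz).trans hy2⟩, hz⟩

noncomputable instance : Mul (P.Blk h) :=
  ⟨fun x y => ⟨_, (exists_comp_of_mem_block x.2 y.2).choose_spec.1⟩⟩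

instance : One (P.Blk h) :=
  ⟨⟨e, mem_block_iff.2 ⟨t_last_of_parallel h, s_last_of_parallel h⟩⟩⟩

instance : Star (P.Blk h) :=
  ⟨fun x => ⟨P.star x.1, mem_block_iff.2
    ⟨(t_last_star _).trans (mem_block_iff.1 x.2).2,
      (s_last_star _).trans (mem_block_iff.1 x.2).1⟩⟩⟩

namespace Blk

lemma mul_mem (x y : P.Blk h) : (x * y).1 ∈ P.comp (Fin.last m) x.1 y.1 :=
  (exists_comp_of_mem_block x.2 y.2).choose_spec.2

lemma eq_mul {x y z : P.Blk h} (hz : z.1 ∈ P.comp (Fin.last m) x.1 y.1) : z = x * y :=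
  ext (comp_unique hz (mul_mem x y))

lemma coe_star (x : P.Blk h) : (Star.star x).1 = P.star x.1 := rfl

protected lemma mul_add (x y z : P.Blk h) : x * (y + z) = x * y + x * z := by
  obtain ⟨v, hv, hv'⟩ := P.comp_add _ _ _ _ _ _ _ (add_mem y z) (mul_mem x y) (mul_mem x z)
  exact eq_add (comp_unique hv (mul_mem x (y + z)) ▸ hv')

protected lemma add_mul (x y z : P.Blk h) : (x + y) * z = x * z + y * z := by
  obtain ⟨v, hv, hv'⟩ := P.add_comp _ _ _ _ _ _ _ (add_mem x y) (mul_mem x z) (mul_mem y z)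
  exact eq_add (comp_unique hv (mul_mem (x + y) z) ▸ hv')

protected lemma smul_mul (c : ℂ) (x y : P.Blk h) : (c • x) * y = c • (x * y) := by
  refine (eq_mul ?_).symm
  rw [coe_smul, coe_smul]
  exact P.smul_comp _ _ _ _ _ (mul_mem x y)

protected lemma mul_smul (c : ℂ) (x y : P.Blk h) : x * (c • y) = c • (x * y) := by
  refine (eq_mul ?_).symm
  rw [coe_smul, coe_smul]
  exact P.comp_smul _ _ _ _ _ (mul_mem x y)

noncomputable instance : NormedRing (P.Blk h) where
  __ := (inferInstance : NormedAddCommGroup (P.Blk h))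
  mul := (· * ·)
  one := 1
  left_distrib := Blk.mul_add
  right_distrib := Blk.add_mul
  zero_mul x := by
    have := Blk.add_mul 0 0 x
    rwa [add_zero, left_eq_add] at this
  mul_zero x := by
    have := Blk.mul_add x 0 0
    rwa [add_zero, left_eq_add] at this
  mul_assoc x y z := eq_mul (assoc_right (mul_mem x y) (mul_mem (x * y) z) (mul_mem y z))
  one_mul x := (eq_mul (by
    have := t_comp (G := P.1) (Fin.last m) x.1
    rwa [(mem_block_iff.1 x.2).1] at this)).symm
  mul_one x := (eq_mul (by
    have := comp_s (G := P.1) (Fin.last m) x.1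
    rwa [(mem_block_iff.1 x.2).2] at this)).symm
  norm_mul_le x y := by
    rw [norm_def, norm_def, norm_def]
    exact P.norm_comp_le _ _ _ _ (mul_mem x y)

/-- Positivity is not used, so C*-algebra theory is available for blocks of transfors before
positivity is proved there. The zero algebra is allowed. -/
noncomputable instance : CStarAlgebra (P.Blk h) where
  __ := (inferInstance : NormedRing (P.Blk h))
  complete := (inferInstance : CompleteSpace (P.Blk h)).complete
  star_involutive x := ext (P.star_star x.1)
  star_mul x y := eq_mul (P.star_comp_top _ _ _ (mul_mem x y))
  star_add x y := eq_add (P.star_add _ _ _ (add_mem x y))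
  norm_mul_self_le x := by
    rw [norm_def, norm_def, ← sq, P.norm_star_comp_self x.1 _ (mul_mem (Star.star x) x)]
  smul := (· • ·)
  algebraMap := (Algebra.ofModule Blk.smul_mul Blk.mul_smul : Algebra ℂ (P.Blk h)).algebraMap
  commutes' := (Algebra.ofModule Blk.smul_mul Blk.mul_smul : Algebra ℂ (P.Blk h)).commutes'
  smul_def' := (Algebra.ofModule Blk.smul_mul Blk.mul_smul : Algebra ℂ (P.Blk h)).smul_def'
  norm_smul_le := (inferInstance : NormedSpace ℂ (P.Blk h)).norm_smul_le
  star_smul c x := ext (by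
    rw [coe_star, coe_smul, P.star_smul, coe_smul]; rfl)

end Blk

end End

end PreLR

end HigherCStar

namespace HigherCStar

open GlobularCategory

/-! ### Positivity detected by a family of representations -/

/-- A selfadjoint element whose images under a jointly faithful family of `*`-homomorphisms are of
the form `y* y` is itself of this form. -/
theorem exists_eq_star_mul_self_of_forall {A : Type*} [CStarAlgebra A] {ι : Type*}
    {B : ι → Type*} [∀ i, CStarAlgebra (B i)] (φ : ∀ i, A →⋆ₙₐ[ℂ] B i)
    (hφ : ∀ x, (∀ i, φ i x = 0) → x = 0) {z : A} (hz : IsSelfAdjoint z)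
    (h : ∀ i, ∃ y, φ i z = star y * y) : ∃ y, z = star y * y := by
  let _ := CStarAlgebra.spectralOrder A
  have _ := CStarAlgebra.spectralOrderedRing A
  let _ := fun i => CStarAlgebra.spectralOrder (B i)
  have _ := fun i => CStarAlgebra.spectralOrderedRing (B i)
  -- The aim is to show that the negative part `q` of `z` vanishes.
  set q : A := z⁻ with hq
  have hq0 : 0 ≤ q := CFC.negPart_nonneg z
  have hqs : star q = q := (IsSelfAdjoint.of_nonneg hq0).star_eq
  obtain ⟨r, hr⟩ := CStarAlgebra.nonneg_iff_eq_star_mul_self.1 hq0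
  -- As `q z⁺ = 0`, the product `q z q` is `-q³`, and `q³ = (r q)* (r q)` for `q = r* r`.
  have hqz : q * z * q = -(star (r * q) * (r * q)) := by
    have h1 : z = z⁺ - q := (CFC.posPart_sub_negPart z hz).symm
    have h2 : q * z⁺ = 0 := CFC.negPart_mul_posPart z
    calc q * z * q = q * (z⁺ - q) * q := by rw [← h1]
      _ = q * z⁺ * q - q * q * q := by noncomm_ring
      _ = -(q * (star r * r) * q) := by rw [h2, ← hr]; noncomm_ring
      _ = _ := by rw [star_mul, hqs]; noncomm_ring
  have hrq : star (r * q) * (r * q) = 0 := by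
    -- With `φ z = y* y`, the image of `q z q` is `(y φ(q))* (y φ(q)) ≥ 0`, while it is also minus
    -- the image of `(r q)* (r q)`, which is itself nonnegative. So each `φ` kills `(r q)* (r q)`.
    refine hφ _ fun i => le_antisymm ?_ ?_
    · obtain ⟨y, hy⟩ := h i
      have h1 : φ i (q * z * q) = star (y * φ i q) * (y * φ i q) := by
        rw [map_mul, map_mul, hy, star_mul, ← map_star, hqs]; noncomm_ring
      have h2 := star_mul_self_nonneg (y * φ i q)
      rwa [← h1, hqz, map_neg, neg_nonneg] at h2
    · rw [map_mul, map_star]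
      exact star_mul_self_nonneg _
  have hq1 : q = 0 := by
    have h1 : r * q = 0 := CStarRing.star_mul_self_eq_zero_iff _ |>.1 hrq
    -- From `r q = 0` one gets `q² = r* (r q) = 0`.
    have h2 : star q * q = 0 := by rw [hqs]; nth_rewrite 1 [hr]; rw [mul_assoc, h1, mul_zero]
    exact CStarRing.star_mul_self_eq_zero_iff _ |>.1 h2
  have : 0 ≤ z := by
    rw [← CFC.posPart_sub_negPart z hz, ← hq, hq1, sub_zero]
    exact CFC.posPart_nonneg z
  exact CStarAlgebra.nonneg_iff_eq_star_mul_self.1 this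

/-! ### Elementary properties of `*`-functors -/

namespace StarFunctor

variable {m : ℕ} {C D : SmallLR.{u} m} (F : StarFunctor C D)

lemma map_s (p : Fin (m + 1)) (x : C.carrier) :
    F.toFun (C.str.s p x) = D.str.s p (F.toFun x) := by
  have h := F.map_comp _ _ _ _ (comp_s (G := C.str.1) p x)
  rw [match_of_comp h, isPartialId_iff_t.1 (F.map_id _ _ (isPartialId_s p x))]

lemma map_t (p : Fin (m + 1)) (x : C.carrier) :
    F.toFun (C.str.t p x) = D.str.t p (F.toFun x) := by
  have h := F.map_comp _ _ _ _ (t_comp (G := C.str.1) p x)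
  rw [← match_of_comp h, isPartialId_iff.1 (F.map_id _ _ (isPartialId_t p x))]

lemma map_mem_block {a b x : C.carrier} (h : x ∈ C.str.block a b) :
    F.toFun x ∈ D.str.block (F.toFun a) (F.toFun b) := by
  obtain ⟨h1, h2⟩ := mem_block_iff.1 h
  exact mem_block_iff.2 ⟨by rw [← map_t, h1], by rw [← map_s, h2]⟩

/-- A `*`-functor as a `*`-homomorphism between endomorphism blocks. -/
noncomputable def endHom {e : C.carrier} (h : C.str.pre.Parallel e e)
    (h' : D.str.pre.Parallel (F.toFun e) (F.toFun e)) :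
    C.str.pre.Blk h →⋆ₙₐ[ℂ] D.str.pre.Blk h' where
  toFun x := PreLR.Blk.mk h' (F.toFun x.1) (F.map_mem_block x.2)
  map_smul' c x := PreLR.Blk.ext (by
    refine Eq.trans ?_ (PreLR.Blk.coe_smul _ _).symm
    exact (congrArg F.toFun (PreLR.Blk.coe_smul c x)).trans (F.map_smul _ _))
  map_zero' := by
    -- Functors preserve the partial addition, so the image of zero is idempotent for addition,
    -- hence zero.
    have h0 := PreLR.Blk.add_mem (0 : C.str.pre.Blk h) 0
    rw [add_zero] at h0
    exact left_eq_add.1 (PreLR.Blk.eq_add (z := PreLR.Blk.mk h' _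
      (F.map_mem_block (0 : C.str.pre.Blk h).2)) (F.map_add _ _ _ h0))
  map_add' x y := PreLR.Blk.eq_add (F.map_add _ _ _ (PreLR.Blk.add_mem x y))
  map_mul' x y := PreLR.Blk.eq_mul (F.map_comp _ _ _ _ (PreLR.Blk.mul_mem x y))
  map_star' x := PreLR.Blk.ext (F.map_star x.1)

/-- `*`-functors are norm decreasing. -/
lemma norm_map_le (x : C.carrier) : D.str.norm (F.toFun x) ≤ C.str.norm x := by
  obtain ⟨z, hz⟩ := C.str.pre.exists_star_comp_self x
  have hz' := F.map_comp _ _ _ _ hz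
  rw [F.map_star] at hz'
  have h : C.str.pre.Parallel (C.str.s (Fin.last m) x) (C.str.s (Fin.last m) x) :=
    parallel_self (s_s _ _)
  have h' : D.str.pre.Parallel (F.toFun (C.str.s (Fin.last m) x))
    (F.toFun (C.str.s (Fin.last m) x)) := parallel_self (by rw [← F.map_s]; simp)
  have hzb : z ∈ C.str.block (C.str.s (Fin.last m) x) (C.str.s (Fin.last m) x) :=
    mem_block_iff.2 ⟨(t_of_comp hz).trans (PreLR.t_last_star _), s_comp hz⟩
  -- The cell `x` need not be an endomorphism, but `z = x* x` is one. Contractivity of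
  -- `*`-homomorphisms applies to `z`, and the C*-property brings the estimate back to `x`.
  have := NonUnitalStarAlgHom.norm_apply_le (F.endHom h h') (PreLR.Blk.mk h z hzb)
  rw [PreLR.Blk.norm_def, PreLR.Blk.norm_def] at this
  have h1 := C.str.norm_star_comp_self _ _ hz
  have h2 := D.str.norm_star_comp_self _ _ hz'
  have h3 : D.str.norm (F.toFun z) ≤ C.str.norm z := this
  rw [h1, h2] at h3
  exact (sq_le_sq₀ (D.str.pre.norm_nonneg _) (C.str.pre.norm_nonneg _)).1 h3

/-- The identity `*`-functor. -/
@[simps] def id (C : SmallLR.{u} m) : StarFunctor C C where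
  toFun x := x
  map_comp _ _ _ _ h := h
  map_id _ _ h := h
  map_star _ := rfl
  map_add _ _ _ h := h
  map_smul _ _ := rfl

/-- Composition of `*`-functors. -/
@[simps] def comp {E : SmallLR.{u} m} (G : StarFunctor D E) (F : StarFunctor C D) :
    StarFunctor C E where
  toFun x := G.toFun (F.toFun x)
  map_comp _ _ _ _ h := G.map_comp _ _ _ _ (F.map_comp _ _ _ _ h)
  map_id _ _ h := G.map_id _ _ (F.map_id _ _ h)
  map_star _ := by rw [F.map_star, G.map_star]
  map_add _ _ _ h := G.map_add _ _ _ (F.map_add _ _ _ h)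
  map_smul _ _ := by rw [F.map_smul, G.map_smul]

end StarFunctor

end HigherCStar

namespace HigherCStar

open GlobularCategory

/-! ### Natural families -/

variable {m : ℕ} {C D E : SmallLR.{u} m}

/-- The source object of a cell. -/
noncomputable def SmallLR.sObj (C : SmallLR.{u} m) (x : C.carrier) : C.Obj :=
  ⟨C.str.s 0 x, isPartialId_s 0 x⟩

/-- The target object of a cell. -/
noncomputable def SmallLR.tObj (C : SmallLR.{u} m) (x : C.carrier) : C.Obj :=
  ⟨C.str.t 0 x, isPartialId_t 0 x⟩

lemma SmallLR.sObj_congr {x y : C.carrier} (h : C.str.s 0 x = C.str.s 0 y) :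
    C.sObj x = C.sObj y := Subtype.ext h

lemma SmallLR.tObj_congr {x y : C.carrier} (h : C.str.t 0 x = C.str.t 0 y) :
    C.tObj x = C.tObj y := Subtype.ext h

lemma StarFunctor.onObj_sObj (F : StarFunctor C D) (x : C.carrier) :
    F.onObj (C.sObj x) = D.sObj (F.toFun x) := Subtype.ext (F.map_s 0 x)

lemma StarFunctor.onObj_tObj (F : StarFunctor C D) (x : C.carrier) :
    F.onObj (C.tObj x) = D.tObj (F.toFun x) := Subtype.ext (F.map_t 0 x)

/-- A family of cells from `Φ` to `Ψ` satisfying the intertwining condition. -/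
structure IsNat (Φ Ψ : StarFunctor C D) (Ξ : C.Obj → D.carrier) : Prop where
  src : ∀ A, D.str.s 0 (Ξ A) = Φ.toFun A.1
  tgt : ∀ A, D.str.t 0 (Ξ A) = Ψ.toFun A.1
  nat : Intertwines Φ Ψ Ξ

namespace IsNat

variable {Φ Φ' Ψ Ψ' Ω : StarFunctor C D} {Ξ X Y Z : C.Obj → D.carrier}

lemma exists_left' (src : ∀ A, D.str.t 0 (Ξ A) = Ψ.toFun A.1) (x : C.carrier) :
    ∃ w, w ∈ D.str.comp 0 (Ψ.toFun x) (Ξ (C.sObj x)) :=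
  exists_comp (by rw [src, ← Ψ.map_s]; rfl)

lemma exists_right' (src : ∀ A, D.str.s 0 (Ξ A) = Φ.toFun A.1) (x : C.carrier) :
    ∃ w, w ∈ D.str.comp 0 (Ξ (C.tObj x)) (Φ.toFun x) :=
  exists_comp (by rw [src, ← Φ.map_t]; rfl)

/-- With the right boundaries both sides of the intertwining condition exist, so it suffices to
compare their values. -/
lemma mk' (src : ∀ A, D.str.s 0 (Ξ A) = Φ.toFun A.1) (tgt : ∀ A, D.str.t 0 (Ξ A) = Ψ.toFun A.1)
    (h : ∀ x w w', w ∈ D.str.comp 0 (Ψ.toFun x) (Ξ (C.sObj x)) →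
      w' ∈ D.str.comp 0 (Ξ (C.tObj x)) (Φ.toFun x) → w = w') : IsNat Φ Ψ Ξ := by
  refine ⟨src, tgt, fun x A B hA hB => ?_⟩
  obtain rfl : C.sObj x = A := Subtype.ext (isSource_iff.1 hA)
  obtain rfl : C.tObj x = B := Subtype.ext (isTarget_iff.1 hB)
  obtain ⟨w, hw⟩ := exists_left' tgt x
  obtain ⟨w', hw'⟩ := exists_right' src x
  obtain rfl := h x w w' hw hw'
  exact comp_congr hw hw'

lemma comp_eq (h : IsNat Φ Ψ Ξ) (x : C.carrier) :
    D.str.comp 0 (Ψ.toFun x) (Ξ (C.sObj x)) = D.str.comp 0 (Ξ (C.tObj x)) (Φ.toFun x) :=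
  h.nat x _ _ (isSource_s _ _ _) (isTarget_t _ _ _)

lemma exists_both (h : IsNat Φ Ψ Ξ) (x : C.carrier) :
    ∃ w, w ∈ D.str.comp 0 (Ψ.toFun x) (Ξ (C.sObj x)) ∧
      w ∈ D.str.comp 0 (Ξ (C.tObj x)) (Φ.toFun x) := by
  obtain ⟨w, hw⟩ := exists_left' h.tgt x
  exact ⟨w, hw, h.comp_eq x ▸ hw⟩

/-- The identity family of a `*`-functor. -/
lemma id (Φ : StarFunctor C D) : IsNat Φ Φ fun A => Φ.toFun A.1 := by
  refine mk' (fun A => ?_) (fun A => ?_) fun x w w' hw hw' => ?_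
  · rw [← Φ.map_s, isPartialId_iff.1 A.2]
  · rw [← Φ.map_t, isPartialId_iff_t.1 A.2]
  · have h1 := Φ.map_comp _ _ _ _ (comp_s (G := C.str.1) 0 x)
    have h2 := Φ.map_comp _ _ _ _ (t_comp (G := C.str.1) 0 x)
    exact (comp_unique hw h1).trans (comp_unique hw' h2).symm

/-- Composition over `*`-functors. -/
lemma vcomp (hX : IsNat Ψ Ω X) (hY : IsNat Φ Ψ Y)
    (hZ : ∀ A, Z A ∈ D.str.comp 0 (X A) (Y A)) : IsNat Φ Ω Z := by
  refine mk' (fun A => (s_comp (hZ A)).trans (hY.src A))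
    (fun A => (t_of_comp (hZ A)).trans (hX.tgt A)) fun x w w' hw hw' => ?_
  obtain ⟨u, hu, hu'⟩ := hX.exists_both x
  obtain ⟨v, hv, hv'⟩ := hY.exists_both x
  have h1 := assoc_left (hZ _) hw hu
  have h2 := assoc_right hu' h1 hv
  have h3 := assoc_left hv' h2 (hZ _)
  exact comp_unique h3 hw'

/-- Composition over transfors. -/
lemma comp {j : Fin (m + 1)} (hj : j ≠ 0) (hX : IsNat Φ Ψ X) (hY : IsNat Φ Ψ Y)
    (hZ : ∀ A, Z A ∈ D.str.comp j (X A) (Y A)) : IsNat Φ Ψ Z := by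
  have hj : 0 < j := Fin.pos_iff_ne_zero.2 hj
  refine mk' (fun A => (s_comp_of_lt hj (hZ A)).trans (hY.src A))
    (fun A => (t_of_comp_of_lt hj (hZ A)).trans (hX.tgt A)) fun x w w' hw hw' => ?_
  have hx := comp_s (G := C.str.1) j x
  obtain ⟨d, e, hd, he, hw⟩ := D.str.exchange _ _ hj _ _ _ _ _ _ _
    (Ψ.map_comp _ _ _ _ hx) (hZ _) hw
  obtain ⟨d', e', hd', he', hw'⟩ := D.str.exchange _ _ hj _ _ _ _ _ _ _ (hZ _)
    (Φ.map_comp _ _ _ _ hx) hw'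
  rw [hX.comp_eq] at hd
  rw [SmallLR.sObj_congr (s_s_of_gt hj x).symm, hY.comp_eq,
    SmallLR.tObj_congr (t_s_of_gt hj x)] at he
  rw [comp_unique hd hd', comp_unique he he'] at hw
  exact comp_unique hw hw'

/-- Composition over objects. -/
lemma hcomp {F G : StarFunctor D E} {U : D.Obj → E.carrier} {V : C.Obj → E.carrier}
    (hU : IsNat F G U) (hX : IsNat Φ Ψ X)
    (hV : ∀ A, V A ∈ E.str.comp 0 (U (Ψ.onObj A)) (F.toFun (X A))) :
    IsNat (F.comp Φ) (G.comp Ψ) V := by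
  refine mk' (fun A => (s_comp (hV A)).trans (by rw [← F.map_s, hX.src]; rfl))
    (fun A => (t_of_comp (hV A)).trans (hU.tgt _)) fun x w w' hw hw' => ?_
  obtain ⟨u, hu, hu'⟩ := hU.exists_both (Ψ.toFun x)
  obtain ⟨v, hv, hv'⟩ := hX.exists_both x
  have hV1 := hV (C.sObj x)
  have hV2 := hV (C.tObj x)
  rw [StarFunctor.onObj_sObj] at hV1
  rw [StarFunctor.onObj_tObj] at hV2
  have h1 := assoc_left hV1 hw hu
  have h2 := assoc_right hu' h1 (F.map_comp _ _ _ _ hv)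
  have h3 := assoc_left (F.map_comp _ _ _ _ hv') h2 hV2
  exact comp_unique h3 hw'

lemma add (hX : IsNat Φ Ψ X) (hY : IsNat Φ Ψ Y)
    (hZ : ∀ A, Z A ∈ D.str.add (X A) (Y A)) : IsNat Φ Ψ Z := by
  refine mk' (fun A => (PreLR.s_add (P := D.str.pre) 0 (hZ A)).trans (hX.src A))
    (fun A => (PreLR.t_add (P := D.str.pre) 0 (hZ A)).trans (hX.tgt A)) fun x w w' hw hw' => ?_
  obtain ⟨u, hu, hu'⟩ := hX.exists_both x
  obtain ⟨v, hv, hv'⟩ := hY.exists_both x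
  obtain ⟨a, ha, ha'⟩ := D.str.comp_add _ _ _ _ _ _ _ (hZ _) hu hv
  obtain ⟨b, hb, hb'⟩ := D.str.add_comp _ _ _ _ _ _ _ (hZ _) hu' hv'
  rw [comp_unique hw ha, comp_unique hw' hb, Part.mem_unique ha' hb']

lemma smul (c : ℂ) (hX : IsNat Φ Ψ X) : IsNat Φ Ψ fun A => D.str.smul c (X A) := by
  refine mk' (fun A => (PreLR.s_smul (P := D.str.pre) 0 c _).trans (hX.src A))
    (fun A => (PreLR.t_smul (P := D.str.pre) 0 c _).trans (hX.tgt A)) fun x w w' hw hw' => ?_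
  obtain ⟨u, hu, hu'⟩ := hX.exists_both x
  exact (comp_unique hw (D.str.comp_smul _ _ _ _ _ hu)).trans
    (comp_unique (D.str.smul_comp _ _ _ _ _ hu') hw')

/-- For `n ≥ 2` the involution is covariant for `∘₀`: the adjoint of the square of `X` at `x*` is
the square of `X*` at `x`. -/
lemma star (hm : m ≠ 0) (hX : IsNat Φ Ψ X) : IsNat Φ Ψ fun A => D.str.star (X A) := by
  have h0 : (0 : Fin (m + 1)) < Fin.last m := Fin.pos_iff_ne_zero.2 (by simpa using hm)
  refine mk' (fun A => (PreLR.s_star_of_lt (P := D.str.pre) h0 _).trans (hX.src A))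
    (fun A => (PreLR.t_star_of_lt (P := D.str.pre) h0 _).trans (hX.tgt A)) fun x w w' hw hw' => ?_
  have h1 := D.str.star_comp _ h0 _ _ _ hw
  have h2 := D.str.star_comp _ h0 _ _ _ hw'
  rw [D.str.star_star, ← StarFunctor.map_star] at h1 h2
  rw [SmallLR.sObj_congr (PreLR.s_star_of_lt (P := C.str.pre) h0 x).symm, hX.comp_eq,
    SmallLR.tObj_congr (PreLR.t_star_of_lt (P := C.str.pre) h0 x)] at h1
  rw [← D.str.star_star w, comp_unique h1 h2, D.str.star_star]

/-- For `n = 1` the involution reverses `∘₀`, so the adjoint of the square at `x*` is read in the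
opposite direction and the two functors change places. -/
lemma star_zero (hm : m = 0) (hX : IsNat Φ Ψ X) : IsNat Ψ Φ fun A => D.str.star (X A) := by
  subst hm
  refine mk' (fun A => (PreLR.s_last_star (P := D.str.pre) _).trans (hX.tgt A))
    (fun A => (PreLR.t_last_star (P := D.str.pre) _).trans (hX.src A)) fun x w w' hw hw' => ?_
  have h1 := D.str.star_comp_top _ _ _ hw
  have h2 := D.str.star_comp_top _ _ _ hw'
  rw [D.str.star_star, ← StarFunctor.map_star] at h1 h2
  have hs : C.sObj x = C.tObj (C.str.star x) :=
    Subtype.ext (PreLR.t_last_star (P := C.str.pre) x).symm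
  have ht : C.tObj x = C.sObj (C.str.star x) :=
    Subtype.ext (PreLR.s_last_star (P := C.str.pre) x).symm
  rw [hs] at h1
  rw [ht] at h2
  have h3 := hX.comp_eq (C.str.star x)
  have h4 : D.str.star w = D.str.star w' := Part.mem_unique h1 (h3 ▸ h2)
  rw [← D.str.star_star w, h4, D.str.star_star]

end IsNat

/-! ### A non-inductive description of transfors -/

lemma IsBoundedFamily.of_le {Ξ : C.Obj → D.carrier} {M : ℝ} (h : ∀ A, D.str.norm (Ξ A) ≤ M) :
    IsBoundedFamily Ξ := ⟨M, by rintro _ ⟨A, rfl⟩; exact h A⟩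

lemma IsBoundedFamily.norm_le {Ξ : C.Obj → D.carrier} (h : IsBoundedFamily Ξ) (A : C.Obj) :
    D.str.norm (Ξ A) ≤ ⨆ A, D.str.norm (Ξ A) := le_ciSup h A

/-- A bounded natural family all of whose iterated sources and targets are natural. -/
structure IsBoundedNat (Φ Ψ : StarFunctor C D) (Ξ : C.Obj → D.carrier) : Prop where
  isNat : IsNat Φ Ψ Ξ
  bounded : IsBoundedFamily Ξ
  isNat_s : ∀ j ≠ 0, IsNat Φ Ψ fun A => D.str.s j (Ξ A)
  isNat_t : ∀ j ≠ 0, IsNat Φ Ψ fun A => D.str.t j (Ξ A)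

lemma s_eq_of_mem_level {n k : ℕ} {α : Type u} {G : GlobularCategory n α} {x : α}
    (h : x ∈ G.level k) (j : Fin n) (hj : k ≤ j) : G.s j x = x := by
  have hk := mem_level_iff.1 h (hj.trans_lt j.2)
  rcases hj.eq_or_lt with rfl | hj
  · exact hk
  · rw [← hk]; exact s_s_of_lt (by exact hj) x

lemma t_eq_of_mem_level {n k : ℕ} {α : Type u} {G : GlobularCategory n α} {x : α}
    (h : x ∈ G.level k) (j : Fin n) (hj : k ≤ j) : G.t j x = x :=
  isPartialId_iff_t.1 (isPartialId_iff.2 (s_eq_of_mem_level h j hj))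

namespace IsBoundedNat

variable {Φ Φ' Ψ Ψ' Ω : StarFunctor C D} {Ξ X Y Z : C.Obj → D.carrier}

/-- By globularity an iterated boundary collapses to a single one, at the lower of the two levels,
whose naturality is already known. -/
lemma s (h : IsBoundedNat Φ Ψ Ξ) {k : Fin (m + 1)} (hk : k ≠ 0) :
    IsBoundedNat Φ Ψ fun A => D.str.s k (Ξ A) where
  isNat := h.isNat_s k hk
  bounded := .of_le fun A => PreLR.norm_id_le_one (P := D.str.pre) (e := D.str.s k (Ξ A)) (by
    rcases (Fin.le_last k).eq_or_lt with rfl | hp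
    · exact s_s _ _
    · exact s_s_of_lt hp _)
  isNat_s j hj := by
    rcases lt_trichotomy j k with hjk | rfl | hjk
    · simpa only [s_s_of_gt hjk] using h.isNat_s j hj
    · simpa only [s_s] using h.isNat_s j hj
    · simpa only [s_s_of_lt hjk] using h.isNat_s k hk
  isNat_t j hj := by
    rcases lt_trichotomy j k with hjk | rfl | hjk
    · simpa only [t_s_of_gt hjk] using h.isNat_t j hj
    · simpa only [t_s] using h.isNat_s j hj
    · simpa only [t_s_of_lt hjk] using h.isNat_s k hk

lemma t (h : IsBoundedNat Φ Ψ Ξ) {k : Fin (m + 1)} (hk : k ≠ 0) :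
    IsBoundedNat Φ Ψ fun A => D.str.t k (Ξ A) where
  isNat := h.isNat_t k hk
  bounded := .of_le fun A => PreLR.norm_id_le_one (P := D.str.pre) (e := D.str.t k (Ξ A)) (by
    rcases (Fin.le_last k).eq_or_lt with rfl | hp
    · exact s_t _ _
    · exact s_t_of_lt hp _)
  isNat_s j hj := by
    rcases lt_trichotomy j k with hjk | rfl | hjk
    · simpa only [s_t_of_gt hjk] using h.isNat_s j hj
    · simpa only [s_t] using h.isNat_t j hj
    · simpa only [s_t_of_lt hjk] using h.isNat_t k hk
  isNat_t j hj := by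
    rcases lt_trichotomy j k with hjk | rfl | hjk
    · simpa only [t_t_of_gt hjk] using h.isNat_t j hj
    · simpa only [t_t] using h.isNat_t j hj
    · simpa only [t_t_of_lt hjk] using h.isNat_t k hk

/-- Climb the tower. The bounding transfors are the componentwise `k`-source and `k`-target;
boundaries below `k` are those of the bounding transfors, and above `k` the components are their own
boundaries. -/
lemma of_isTransfor {k : ℕ} (h : IsTransfor Φ Ψ k Ξ) : IsBoundedNat Φ Ψ Ξ := by
  induction h with
  | one Ξ mem_level source target intertwines bounded =>
    have hN : IsNat Φ Ψ Ξ :=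
      ⟨fun A => isSource_iff.1 (source A), fun A => isTarget_iff.1 (target A), intertwines⟩
    refine ⟨hN, bounded, fun j hj => ?_, fun j hj => ?_⟩
    · simpa only [s_eq_of_mem_level (mem_level _) j (Fin.pos_iff_ne_zero.2 hj)] using hN
    · simpa only [t_eq_of_mem_level (mem_level _) j (Fin.pos_iff_ne_zero.2 hj)] using hN
  | succ k hk Θ Ω Ξ hΘ hΩ mem_level source target intertwines bounded ihΘ ihΩ =>
    obtain rfl : _ = Θ := funext fun A => isSource_iff.1 (source A)
    obtain rfl : _ = Ω := funext fun A => isTarget_iff.1 (target A)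
    have hk0 : 0 < k := by cases hΘ <;> omega
    have hk0' : (0 : Fin (m + 1)) < ⟨k, hk⟩ := hk0
    have hN : IsNat Φ Ψ Ξ := by
      refine ⟨fun A => ?_, fun A => ?_, intertwines⟩
      · rw [← ihΘ.isNat.src A, s_s_of_gt hk0']
      · rw [← ihΩ.isNat.tgt A, t_t_of_gt hk0']
    refine ⟨hN, bounded, fun j hj => ?_, fun j hj => ?_⟩
    · rcases lt_trichotomy j ⟨k, hk⟩ with hjk | rfl | hjk
      · simpa only [s_s_of_gt hjk] using ihΘ.isNat_s j hj
      · exact ihΘ.isNat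
      · simpa only [s_eq_of_mem_level (mem_level _) j hjk] using hN
    · rcases lt_trichotomy j ⟨k, hk⟩ with hjk | rfl | hjk
      · simpa only [t_t_of_gt hjk] using ihΩ.isNat_t j hj
      · exact ihΩ.isNat
      · simpa only [t_eq_of_mem_level (mem_level _) j hjk] using hN

/-- The tower is rebuilt downwards, with componentwise sources and targets as bounding transfors. -/
lemma isTransfor {k : ℕ} (hk : k < m + 1) (hl : ∀ A, Ξ A ∈ D.str.level (k + 1))
    (h : IsBoundedNat Φ Ψ Ξ) : IsTransfor Φ Ψ (k + 1) Ξ := by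
  induction k generalizing Ξ with
  | zero =>
    exact .one Ξ hl (fun A => isSource_iff.2 (h.isNat.src A))
      (fun A => isTarget_iff.2 (h.isNat.tgt A)) h.isNat.nat h.bounded
  | succ k ih =>
    have hk0 : (⟨k + 1, hk⟩ : Fin (m + 1)) ≠ 0 := by simp [Fin.ext_iff]
    refine .succ (k + 1) hk (fun A => D.str.s ⟨k + 1, hk⟩ (Ξ A))
      (fun A => D.str.t ⟨k + 1, hk⟩ (Ξ A)) Ξ
      (ih (by omega) (fun A => mem_level_iff.2 fun _ => s_s _ _) (h.s hk0))
      (ih (by omega) (fun A => mem_level_iff.2 fun _ => s_t _ _) (h.t hk0)) hl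
      (fun A => isSource_s _ _ _) (fun A => isTarget_t _ _ _) h.isNat.nat h.bounded

lemma isTransfor_top (h : IsBoundedNat Φ Ψ Ξ) : IsTransfor Φ Ψ (m + 1) Ξ :=
  h.isTransfor (Nat.lt_succ_self m) fun _ => mem_level_iff.2 fun h => absurd h (lt_irrefl _)

lemma id (Φ : StarFunctor C D) : IsBoundedNat Φ Φ fun A => Φ.toFun A.1 := by
  have hs : ∀ j A, D.str.s j (Φ.toFun (A : C.Obj).1) = Φ.toFun A.1 := fun j A => by
    rw [← Φ.map_s]
    rcases (Fin.zero_le j).eq_or_lt with rfl | hj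
    · rw [isPartialId_iff.1 A.2]
    · rw [isPartialId_iff.1 (C.str.id_mono _ _ hj _ A.2)]
  refine ⟨.id Φ, .of_le fun A => PreLR.norm_id_le_one (P := D.str.pre) (hs _ A), ?_, ?_⟩
  · intro j _
    simpa only [hs] using IsNat.id Φ
  · intro j _
    simpa only [isPartialId_iff_t.1 (isPartialId_iff.2 (hs _ _))] using IsNat.id Φ

lemma vcomp (hX : IsBoundedNat Ψ Ω X) (hY : IsBoundedNat Φ Ψ Y)
    (hZ : ∀ A, Z A ∈ D.str.comp 0 (X A) (Y A)) : IsBoundedNat Φ Ω Z where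
  isNat := hX.isNat.vcomp hY.isNat hZ
  bounded := .of_le fun A => (D.str.norm_comp_le _ _ _ _ (hZ A)).trans
    (mul_le_mul (hX.bounded.norm_le A) (hY.bounded.norm_le A) (D.str.pre.norm_nonneg _)
      (Real.iSup_nonneg fun _ => D.str.pre.norm_nonneg _))
  isNat_s j hj := (hX.isNat_s j hj).vcomp (hY.isNat_s j hj) fun A =>
    s_comp_of_gt (Fin.pos_iff_ne_zero.2 hj) (hZ A)
  isNat_t j hj := (hX.isNat_t j hj).vcomp (hY.isNat_t j hj) fun A =>
    t_comp_of_gt (Fin.pos_iff_ne_zero.2 hj) (hZ A)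

lemma comp {k : Fin (m + 1)} (hk : k ≠ 0) (hX : IsBoundedNat Φ Ψ X) (hY : IsBoundedNat Φ Ψ Y)
    (hZ : ∀ A, Z A ∈ D.str.comp k (X A) (Y A)) : IsBoundedNat Φ Ψ Z where
  isNat := hX.isNat.comp hk hY.isNat hZ
  bounded := .of_le fun A => (D.str.norm_comp_le _ _ _ _ (hZ A)).trans
    (mul_le_mul (hX.bounded.norm_le A) (hY.bounded.norm_le A) (D.str.pre.norm_nonneg _)
      (Real.iSup_nonneg fun _ => D.str.pre.norm_nonneg _))
  isNat_s j hj := by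
    rcases lt_trichotomy k j with hjk | rfl | hjk
    · exact (hX.isNat_s j hj).comp hk (hY.isNat_s j hj) fun A => s_comp_of_gt hjk (hZ A)
    · simpa only [s_comp (hZ _)] using hY.isNat_s k hk
    · simpa only [s_comp_of_lt hjk (hZ _)] using hY.isNat_s j hj
  isNat_t j hj := by
    rcases lt_trichotomy k j with hjk | rfl | hjk
    · exact (hX.isNat_t j hj).comp hk (hY.isNat_t j hj) fun A => t_comp_of_gt hjk (hZ A)
    · simpa only [t_of_comp (hZ _)] using hX.isNat_t k hk
    · simpa only [t_of_comp_of_lt hjk (hZ _)] using hX.isNat_t j hj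

/-- The bound on `F(X(A))` uses that `*`-functors are norm decreasing; boundaries commute with `F`.
-/
lemma hcomp {F G : StarFunctor D E} {U : D.Obj → E.carrier} {V : C.Obj → E.carrier}
    (hU : IsBoundedNat F G U) (hX : IsBoundedNat Φ Ψ X)
    (hV : ∀ A, V A ∈ E.str.comp 0 (U (Ψ.onObj A)) (F.toFun (X A))) :
    IsBoundedNat (F.comp Φ) (G.comp Ψ) V where
  isNat := hU.isNat.hcomp hX.isNat hV
  bounded := .of_le fun A => (E.str.norm_comp_le _ _ _ _ (hV A)).trans
    (mul_le_mul (hU.bounded.norm_le _) ((F.norm_map_le _).trans (hX.bounded.norm_le A))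
      (E.str.pre.norm_nonneg _) (Real.iSup_nonneg fun _ => E.str.pre.norm_nonneg _))
  isNat_s j hj := (hU.isNat_s j hj).hcomp (hX.isNat_s j hj) fun A => by
    rw [F.map_s]; exact s_comp_of_gt (Fin.pos_iff_ne_zero.2 hj) (hV A)
  isNat_t j hj := (hU.isNat_t j hj).hcomp (hX.isNat_t j hj) fun A => by
    rw [F.map_t]; exact t_comp_of_gt (Fin.pos_iff_ne_zero.2 hj) (hV A)

lemma add (hX : IsBoundedNat Φ Ψ X) (hY : IsBoundedNat Φ Ψ Y)
    (hZ : ∀ A, Z A ∈ D.str.add (X A) (Y A)) : IsBoundedNat Φ Ψ Z where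
  isNat := hX.isNat.add hY.isNat hZ
  bounded := .of_le fun A => (PreLR.norm_add_le (P := D.str.pre) (hZ A)).trans
    (add_le_add (hX.bounded.norm_le A) (hY.bounded.norm_le A))
  isNat_s j hj := by
    simpa only [PreLR.s_add (P := D.str.pre) j (hZ _)] using hX.isNat_s j hj
  isNat_t j hj := by
    simpa only [PreLR.t_add (P := D.str.pre) j (hZ _)] using hX.isNat_t j hj

lemma smul (c : ℂ) (hX : IsBoundedNat Φ Ψ X) : IsBoundedNat Φ Ψ fun A => D.str.smul c (X A) where
  isNat := hX.isNat.smul c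
  bounded := .of_le fun A => (D.str.pre.norm_smul c (X A)).trans_le
    (mul_le_mul_of_nonneg_left (hX.bounded.norm_le A) (norm_nonneg c))
  isNat_s j hj := by
    simpa only [PreLR.s_smul (P := D.str.pre)] using hX.isNat_s j hj
  isNat_t j hj := by
    simpa only [PreLR.t_smul (P := D.str.pre)] using hX.isNat_t j hj

lemma star (hm : m ≠ 0) (hX : IsBoundedNat Φ Ψ X) :
    IsBoundedNat Φ Ψ fun A => D.str.star (X A) where
  isNat := hX.isNat.star hm
  bounded := .of_le fun A => (D.str.pre.norm_star (X A)).trans_le (hX.bounded.norm_le A)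
  isNat_s j hj := by
    rcases (Fin.le_last j).eq_or_lt with rfl | hp
    · simpa only [PreLR.s_last_star (P := D.str.pre)] using hX.isNat_t _ hj
    · simpa only [PreLR.s_star_of_lt (P := D.str.pre) hp] using hX.isNat_s _ hj
  isNat_t j hj := by
    rcases (Fin.le_last j).eq_or_lt with rfl | hp
    · simpa only [PreLR.t_last_star (P := D.str.pre)] using hX.isNat_s _ hj
    · simpa only [PreLR.t_star_of_lt (P := D.str.pre) hp] using hX.isNat_t _ hj

lemma star_zero (hm : m = 0) (hX : IsBoundedNat Φ Ψ X) :
    IsBoundedNat Ψ Φ fun A => D.str.star (X A) where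
  isNat := hX.isNat.star_zero hm
  bounded := .of_le fun A => (D.str.pre.norm_star (X A)).trans_le (hX.bounded.norm_le A)
  isNat_s j hj := absurd (Fin.ext (by omega)) hj
  isNat_t j hj := absurd (Fin.ext (by omega)) hj

end IsBoundedNat

end HigherCStar

namespace HigherCStar

open GlobularCategory

variable {m : ℕ} {C D E : SmallLR.{u} m}

/-! ### Compositions of transfors -/

namespace NTransfor

@[ext] lemma ext {X Y : NTransfor C D} (src : X.src = Y.src) (tgt : X.tgt = Y.tgt)
    (map : ∀ A, X.map A = Y.map A) : X = Y := by
  obtain ⟨_, _, f, _⟩ := X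
  obtain ⟨_, _, g, _⟩ := Y
  obtain rfl : f = g := funext map
  cases src
  cases tgt
  rfl

lemma isBoundedNat (X : NTransfor C D) : IsBoundedNat X.src X.tgt X.map :=
  .of_isTransfor X.isTransfor

lemma s_zero_map (X : NTransfor C D) (A : C.Obj) : D.str.s 0 (X.map A) = X.src.toFun A.1 :=
  X.isBoundedNat.isNat.src A

lemma t_zero_map (X : NTransfor C D) (A : C.Obj) : D.str.t 0 (X.map A) = X.tgt.toFun A.1 :=
  X.isBoundedNat.isNat.tgt A

lemma sObj_map (X : NTransfor C D) (A : C.Obj) : D.sObj (X.map A) = X.src.onObj A :=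
  Subtype.ext (X.s_zero_map A)

lemma tObj_map (X : NTransfor C D) (A : C.Obj) : D.tObj (X.map A) = X.tgt.onObj A :=
  Subtype.ext (X.t_zero_map A)

/-- A transfor given by a bounded natural family. -/
@[simps] def ofIsBoundedNat {Φ Ψ : StarFunctor C D} {Ξ : C.Obj → D.carrier}
    (h : IsBoundedNat Φ Ψ Ξ) : NTransfor C D := ⟨Φ, Ψ, Ξ, h.isTransfor_top⟩

/-- The `j`-source of a transfor, taken componentwise. -/
@[simps] noncomputable def s (j : Fin (m + 1)) (X : NTransfor C D) : NTransfor C D where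
  src := X.src
  -- The `0`-source is the identity transfor of the source functor; higher sources keep both
  -- functors.
  tgt := if j = 0 then X.src else X.tgt
  map A := D.str.s j (X.map A)
  isTransfor := by
    apply IsBoundedNat.isTransfor_top
    split_ifs with h
    · simpa only [h, s_zero_map] using IsBoundedNat.id X.src
    · exact X.isBoundedNat.s h

/-- The `j`-target of a transfor, taken componentwise. -/
@[simps] noncomputable def t (j : Fin (m + 1)) (X : NTransfor C D) : NTransfor C D where
  src := if j = 0 then X.tgt else X.src
  tgt := X.tgt
  map A := D.str.t j (X.map A)
  isTransfor := by
    apply IsBoundedNat.isTransfor_top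
    split_ifs with h
    · simpa only [h, t_zero_map] using IsBoundedNat.id X.tgt
    · exact X.isBoundedNat.t h

/-- `Z` is the composite of `X` and `Y` with components `X(A) ∘ⱼ Y(A)`. -/
structure VComp (j : Fin (m + 1)) (X Y Z : NTransfor C D) : Prop where
  middle : j = 0 → X.src = Y.tgt
  bdry : j ≠ 0 → X.src = Y.src ∧ X.tgt = Y.tgt
  src : Z.src = Y.src
  tgt : Z.tgt = X.tgt
  map : ∀ A, Z.map A ∈ D.str.comp j (X.map A) (Y.map A)

/-! ### Componentwise composition of transfors; the index `j` stands for `∘ⱼ₊₁` of cells. -/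

namespace VComp

variable {i j : Fin (m + 1)} {X Y Z Z' U V W : NTransfor C D}

lemma unique (h : VComp j X Y Z) (h' : VComp j X Y Z') : Z = Z' :=
  ext (h.src.trans h'.src.symm) (h.tgt.trans h'.tgt.symm) fun A => comp_unique (h.map A) (h'.map A)

/-- The chosen componentwise composites form a transfor by the closure properties of bounded natural
families. -/
lemma exists_of_forall (middle : j = 0 → X.src = Y.tgt)
    (bdry : j ≠ 0 → X.src = Y.src ∧ X.tgt = Y.tgt)
    (h : ∀ A, ∃ z, z ∈ D.str.comp j (X.map A) (Y.map A)) : ∃ Z, VComp j X Y Z := by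
  choose Z hZ using h
  have : IsBoundedNat Y.src X.tgt Z := by
    by_cases hj : j = 0
    · subst hj
      have hX := X.isBoundedNat
      rw [middle rfl] at hX
      exact hX.vcomp Y.isBoundedNat hZ
    · have hX := X.isBoundedNat
      have hY := Y.isBoundedNat
      rw [(bdry hj).1] at hX
      rw [← (bdry hj).2] at hY
      exact hX.comp hj hY hZ
  exact ⟨ofIsBoundedNat this, middle, bdry, rfl, rfl, hZ⟩

lemma exists_of_match (h : X.s j = Y.t j) : ∃ Z, VComp j X Y Z := by
  have h1 := congrArg NTransfor.src h
  have h2 := congrArg NTransfor.tgt h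
  refine exists_of_forall (fun hj => by simpa [hj] using h1)
    (fun hj => ⟨by simpa [hj] using h1, by simpa [hj] using h2⟩) fun A => ?_
  exact exists_comp (congrFun (congrArg NTransfor.map h) A)

lemma match_ (h : VComp j X Y Z) : X.s j = Y.t j := by
  refine ext ?_ ?_ fun A => match_of_comp (h.map A)
  · by_cases hj : j = 0
    · simp [hj, h.middle hj]
    · simp [hj, h.bdry hj]
  · by_cases hj : j = 0
    · simp [hj, h.middle hj]
    · simp [hj, h.bdry hj]

lemma s_eq (h : VComp j X Y Z) : Z.s j = Y.s j := by
  refine ext h.src ?_ fun A => s_comp (h.map A)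
  by_cases hj : j = 0
  · simp [hj, h.src]
  · simp [hj, h.tgt, h.bdry hj]

lemma t_eq (h : VComp j X Y Z) : Z.t j = X.t j := by
  refine ext ?_ h.tgt fun A => t_of_comp (h.map A)
  by_cases hj : j = 0
  · simp [hj, h.tgt]
  · simp [hj, h.src, h.bdry hj]

lemma id_right (j : Fin (m + 1)) (X : NTransfor C D) : VComp j X (X.s j) X where
  middle hj := by simp [hj]
  bdry hj := by simp [hj]
  src := rfl
  tgt := rfl
  map A := comp_s _ _

lemma id_left (j : Fin (m + 1)) (X : NTransfor C D) : VComp j (X.t j) X X where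
  middle hj := by simp [hj]
  bdry hj := by simp [hj]
  src := rfl
  tgt := rfl
  map A := t_comp _ _

lemma assoc (h : VComp j X Y U) (h' : VComp j Y Z V) (h'' : VComp j U Z W) : VComp j X V W where
  middle hj := by rw [h.middle hj, h'.tgt]
  bdry hj := by rw [(h.bdry hj).1, (h.bdry hj).2, h'.src, h'.tgt]; exact ⟨(h'.bdry hj).1, rfl⟩
  src := by rw [h''.src, h'.src]
  tgt := by rw [h''.tgt, h.tgt]
  map A := assoc_right (h.map A) (h''.map A) (h'.map A)

lemma s_of_lt (hij : i < j) (h : VComp i X Y Z) : VComp i (X.s j) (Y.s j) (Z.s j) := by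
  have hj : j ≠ 0 := (Fin.zero_le i |>.trans_lt hij).ne'
  constructor
  · simpa [hj] using h.middle
  · simpa [hj] using h.bdry
  · exact h.src
  · simpa [hj] using h.tgt
  · exact fun A => s_comp_of_gt hij (h.map A)

lemma exchange (hij : i < j) {a b c x y w z : NTransfor C D} (ha : VComp j x y a)
    (hb : VComp j w z b) (hc : VComp i a b c) :
    ∃ d e, VComp i x w d ∧ VComp i y z e ∧ VComp j d e c := by
  have hj : j ≠ 0 := (Fin.zero_le i |>.trans_lt hij).ne'
  have H := fun A => D.str.exchange _ _ hij _ _ _ _ _ _ _ (ha.map A) (hb.map A) (hc.map A)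
  obtain ⟨hxy, hxy'⟩ := ha.bdry hj
  obtain ⟨hwz, hwz'⟩ := hb.bdry hj
  obtain ⟨d, hd⟩ : ∃ d, VComp i x w d := by
    refine exists_of_forall (fun hi => ?_) (fun hi => ?_) fun A => ?_
    · rw [hxy, ← ha.src, hc.middle hi, hb.tgt]
    · rw [hxy, ← ha.src, (hc.bdry hi).1, hb.src, hwz, ← ha.tgt, (hc.bdry hi).2, hb.tgt]
      exact ⟨rfl, rfl⟩
    · obtain ⟨d, e, hd, he, -⟩ := H A
      exact ⟨d, hd⟩
  obtain ⟨e, he⟩ : ∃ e, VComp i y z e := by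
    refine exists_of_forall (fun hi => ?_) (fun hi => ?_) fun A => ?_
    · rw [← ha.src, hc.middle hi, hb.tgt, hwz']
    · rw [← ha.src, (hc.bdry hi).1, hb.src, ← hxy', ← ha.tgt, (hc.bdry hi).2, hb.tgt, hwz']
      exact ⟨rfl, rfl⟩
    · obtain ⟨d, e, hd, he, -⟩ := H A
      exact ⟨e, he⟩
  refine ⟨d, e, hd, he, fun h => absurd h hj, fun _ => ⟨?_, ?_⟩, ?_, ?_, fun A => ?_⟩
  · rw [hd.src, he.src, hwz]
  · rw [hd.tgt, he.tgt, hxy']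
  · rw [hc.src, he.src, hb.src]
  · rw [hc.tgt, hd.tgt, ha.tgt]
  · obtain ⟨d', e', hd', he', hc'⟩ := H A
    rwa [comp_unique (hd.map A) hd', comp_unique (he.map A) he']

end VComp

lemma s_s_of_lt {i j : Fin (m + 1)} (hij : i < j) (X : NTransfor C D) : (X.s i).s j = X.s i := by
  have hj : j ≠ 0 := (Fin.zero_le i |>.trans_lt hij).ne'
  exact ext rfl (by simp [hj]) fun A => GlobularCategory.s_s_of_lt hij _

/-- `Z` is the composite of `X` and `Y` over objects. -/
structure HComp (X : NTransfor D E) (Y : NTransfor C D) (Z : NTransfor C E) : Prop where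
  src : Z.src = X.src.comp Y.src
  tgt : Z.tgt = X.tgt.comp Y.tgt
  map : ∀ A, Z.map A ∈ E.str.comp 0 (X.map (Y.tgt.onObj A)) (X.src.toFun (Y.map A))

/-- The identity transfor of the identity functor. -/
def one (C : SmallLR.{u} m) : NTransfor C C := ofIsBoundedNat (IsBoundedNat.id (StarFunctor.id C))

/-! ### Composition of transfors over objects. -/

namespace HComp

variable {F : SmallLR.{u} m} {X x y a : NTransfor D E} {Y w z b : NTransfor C D}
  {Z Z' c : NTransfor C E}

lemma unique (h : HComp X Y Z) (h' : HComp X Y Z') : Z = Z' :=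
  ext (h.src.trans h'.src.symm) (h.tgt.trans h'.tgt.symm) fun A => comp_unique (h.map A) (h'.map A)

lemma exists_hcomp (X : NTransfor D E) (Y : NTransfor C D) : ∃ Z, HComp X Y Z := by
  have h : ∀ A, ∃ z, z ∈ E.str.comp 0 (X.map (Y.tgt.onObj A)) (X.src.toFun (Y.map A)) :=
    fun A => exists_comp (by rw [s_zero_map, ← StarFunctor.map_t, t_zero_map]; rfl)
  choose Z hZ using h
  exact ⟨ofIsBoundedNat (X.isBoundedNat.hcomp Y.isBoundedNat hZ), rfl, rfl, hZ⟩

lemma one_right (X : NTransfor C D) : HComp X (one C) X where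
  src := rfl
  tgt := rfl
  map A := by
    have := comp_s (G := D.str.1) 0 (X.map A)
    rwa [s_zero_map] at this

lemma one_left (X : NTransfor C D) : HComp (one D) X X where
  src := rfl
  tgt := rfl
  map A := by
    have := t_comp (G := D.str.1) 0 (X.map A)
    rwa [t_zero_map] at this

lemma assoc {X : NTransfor E F} {Y : NTransfor D E} {Z : NTransfor C D} {U : NTransfor D F}
    {V : NTransfor C E} {W : NTransfor C F} (h : HComp X Y U) (h' : HComp Y Z V)
    (h'' : HComp U Z W) : HComp X V W where
  src := by rw [h''.src, h.src, h'.src]; rfl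
  tgt := by rw [h''.tgt, h.tgt, h'.tgt]; rfl
  map A := by
    have h1 := h''.map A
    rw [h.src] at h1
    have h2 := X.src.map_comp _ _ _ _ (h'.map A)
    have h3 := assoc_right (h.map _) h1 h2
    rw [h'.tgt]
    exact h3

lemma s (h : HComp X Y Z) (j : Fin (m + 1)) : HComp (X.s j) (Y.s j) (Z.s j) := by
  by_cases hj : j = 0
  · subst hj
    refine ⟨h.src, by simp [h.src], fun A => ?_⟩
    have h1 : (Z.s 0).map A = X.src.toFun (Y.src.toFun A.1) := by
      simp [s_zero_map, h.src]
    have h2 : (X.s 0).src.toFun ((Y.s 0).map A) = X.src.toFun (Y.src.toFun A.1) := by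
      simp [s_zero_map]
    have h3 : (X.s 0).map ((Y.s 0).tgt.onObj A) = X.src.toFun (Y.src.toFun A.1) := by
      simp only [NTransfor.s_map, s_zero_map]; rfl
    rw [h1, h2, h3]
    exact id_comp_self (X.src.map_id _ _ (Y.src.map_id _ _ A.2))
  · refine ⟨h.src, by simp [hj, h.tgt], fun A => ?_⟩
    have := s_comp_of_gt (Fin.pos_iff_ne_zero.2 hj) (h.map A)
    rw [← StarFunctor.map_s] at this
    simpa [hj] using this

/-- For `j ≠ 0` this is exchange in `E`. For `j = 0` both compositions are `∘₀` on components and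
exchange says nothing; the interchange law comes from naturality of `y`. -/
lemma exchange {j : Fin (m + 1)} (ha : VComp j x y a) (hb : VComp j w z b) (hc : HComp a b c) :
    ∃ d e, HComp x w d ∧ HComp y z e ∧ VComp j d e c := by
  obtain ⟨d, hd⟩ := exists_hcomp x w
  obtain ⟨e, he⟩ := exists_hcomp y z
  refine ⟨d, e, hd, he, fun hj => ?_, fun hj => ?_, ?_, ?_, fun A => ?_⟩
  · rw [hd.src, he.tgt, ha.middle hj, hb.middle hj]
  · rw [hd.src, hd.tgt, he.src, he.tgt, (ha.bdry hj).1, (ha.bdry hj).2, (hb.bdry hj).1,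
      (hb.bdry hj).2]
    exact ⟨rfl, rfl⟩
  · rw [hc.src, he.src, ha.src, hb.src]
  · rw [hc.tgt, hd.tgt, ha.tgt, hb.tgt]
  · have hcA := hc.map A
    have hdA := hd.map A
    have heA := he.map A
    have haA := ha.map (b.tgt.onObj A)
    have hbA := a.src.map_comp _ _ _ _ (hb.map A)
    rw [ha.src] at hcA hbA
    rw [hb.tgt] at hcA haA
    by_cases hj : j = 0
    · subst hj
      obtain ⟨v, hv, hcv⟩ := exists_assoc_right haA hcA
      obtain ⟨k, hk, hvk⟩ := exists_assoc_left hbA hv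
      -- In the fourfold composite of `x`, `y`, `Φ(w)`, `Φ(z)`, where `Φ` is the source functor of
      -- `y`, the two middle factors are swapped by the square of `y` at the cell `w(A)`.
      have hN := y.isBoundedNat.isNat.comp_eq (w.map A)
      rw [sObj_map, tObj_map, ← ha.middle rfl] at hN
      have hk' := hN.symm ▸ hk
      rw [hb.middle rfl] at hk'
      exact assoc_left (assoc_right hk' hvk heA) hcv hdA
    · rw [(ha.bdry hj).1] at hdA
      rw [← (hb.bdry hj).2] at heA
      obtain ⟨d', e', hd', he', hc'⟩ := E.str.exchange _ _ (Fin.pos_iff_ne_zero.2 hj) _ _ _ _ _ _ _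
        haA hbA hcA
      rwa [comp_unique hdA hd', comp_unique heA he']

end HComp

end NTransfor

/-! ### The globular category of transfors -/

open NTransfor

lemma isTransforComp_zero_iff {X Y Z : Cell.{u} m} : IsTransforComp 0 X Y Z ↔
    ∃ (C D E : SmallLR.{u} m) (X' : NTransfor D E) (Y' : NTransfor C D) (Z' : NTransfor C E),
      X = ⟨D, E, X'⟩ ∧ Y = ⟨C, D, Y'⟩ ∧ Z = ⟨C, E, Z'⟩ ∧ HComp X' Y' Z' := by
  constructor
  · intro h
    generalize hk : (0 : Fin (m + 1 + 1)) = k at h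
    cases h with
    | zero X Y Z src tgt map =>
      exact ⟨_, _, _, _, _, _, rfl, rfl, rfl, StarFunctor.ext (funext src),
        StarFunctor.ext (funext tgt), map⟩
    | one => exact absurd hk (Fin.succ_ne_zero _).symm
    | succ => exact absurd hk (Fin.succ_ne_zero _).symm
  · rintro ⟨C, D, E, X', Y', Z', rfl, rfl, rfl, h⟩
    exact .zero _ _ _ (fun x => by rw [h.src]; rfl) (fun x => by rw [h.tgt]; rfl) h.map

/-- The cases of composition over functors and over lower transfors merge into `VComp`, so they can
be treated together. -/
lemma isTransforComp_succ_iff {j : Fin (m + 1)} {X Y Z : Cell.{u} m} :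
    IsTransforComp j.succ X Y Z ↔ ∃ (C D : SmallLR.{u} m) (X' Y' Z' : NTransfor C D),
      X = ⟨C, D, X'⟩ ∧ Y = ⟨C, D, Y'⟩ ∧ Z = ⟨C, D, Z'⟩ ∧ VComp j X' Y' Z' := by
  constructor
  · intro h
    generalize hk : j.succ = k at h
    cases h with
    | zero => exact absurd hk (Fin.succ_ne_zero _)
    | one X Y Z middle src tgt map =>
      obtain rfl := Fin.succ_injective _ hk
      exact ⟨_, _, _, _, _, rfl, rfl, rfl, fun _ => middle, fun h => absurd rfl h, src, tgt, map⟩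
    | succ i hi X Y Z sl sr tl tr map =>
      obtain rfl := Fin.succ_injective _ hk
      exact ⟨_, _, _, _, _, rfl, rfl, rfl, fun h => absurd h hi,
        fun _ => ⟨sl.symm.trans sr, tl.symm.trans tr⟩, sr, tl, map⟩
  · rintro ⟨C, D, X', Y', Z', rfl, rfl, rfl, h⟩
    by_cases hj : j = 0
    · subst hj
      exact .one _ _ _ (h.middle rfl) h.src h.tgt h.map
    · exact .succ _ hj _ _ _ (h.src.trans (h.bdry hj).1.symm) h.src h.tgt
        (h.tgt.trans (h.bdry hj).2) h.map

namespace Cell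

/-- The sources of a cell. -/
noncomputable def s (k : Fin (m + 1 + 1)) (X : Cell.{u} m) : Cell.{u} m :=
  Fin.cases ⟨X.dom, X.dom, NTransfor.one X.dom⟩ (fun j => ⟨X.dom, X.cod, X.transfor.s j⟩) k

/-- The targets of a cell. -/
noncomputable def t (k : Fin (m + 1 + 1)) (X : Cell.{u} m) : Cell.{u} m :=
  Fin.cases ⟨X.cod, X.cod, NTransfor.one X.cod⟩ (fun j => ⟨X.dom, X.cod, X.transfor.t j⟩) k

lemma s_zero (X : Cell.{u} m) : X.s 0 = ⟨X.dom, X.dom, NTransfor.one X.dom⟩ := rfl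
lemma s_succ (j : Fin (m + 1)) (X : Cell.{u} m) :
    X.s j.succ = ⟨X.dom, X.cod, X.transfor.s j⟩ := rfl
lemma t_succ (j : Fin (m + 1)) (X : Cell.{u} m) :
    X.t j.succ = ⟨X.dom, X.cod, X.transfor.t j⟩ := rfl

/-- The globular category of bounded transfors. -/
noncomputable def globular (m : ℕ) : GlobularCategory (m + 1 + 1) (Cell.{u} m) :=
  .ofRel IsTransforComp s t
    (unique := by
      intro p X Y Z Z' k k'
      cases p using Fin.cases with
      | zero =>
        obtain ⟨_, _, _, X, Y, Z, rfl, rfl, rfl, h⟩ := isTransforComp_zero_iff.1 k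
        obtain ⟨_, _, _, X', Y', Z', hX, hY, rfl, h'⟩ := isTransforComp_zero_iff.1 k'
        cases hX; cases hY
        rw [h.unique h']
      | succ j =>
        obtain ⟨_, _, X, Y, Z, rfl, rfl, rfl, h⟩ := isTransforComp_succ_iff.1 k
        obtain ⟨_, _, X', Y', Z', hX, hY, rfl, h'⟩ := isTransforComp_succ_iff.1 k'
        cases hX; cases hY
        rw [h.unique h'])
    (ex := by
      rintro p ⟨C, D, X⟩ ⟨C', D', Y⟩ h
      cases p using Fin.cases with
      | zero =>
        obtain rfl : C = D' := congrArg Cell.dom h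
        obtain ⟨Z, hZ⟩ := HComp.exists_hcomp X Y
        exact ⟨_, isTransforComp_zero_iff.2 ⟨_, _, _, _, _, Z, rfl, rfl, rfl, hZ⟩⟩
      | succ j =>
        obtain rfl : C = C' := congrArg Cell.dom h
        obtain rfl : D = D' := congrArg Cell.cod h
        have h : X.s j = Y.t j := by
          rw [s_succ, t_succ] at h
          simpa using h
        obtain ⟨Z, hZ⟩ := VComp.exists_of_match h
        exact ⟨_, isTransforComp_succ_iff.2 ⟨_, _, _, _, Z, rfl, rfl, rfl, hZ⟩⟩)
    (mat := by
      intro p X Y Z k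
      cases p using Fin.cases with
      | zero =>
        obtain ⟨_, _, _, X, Y, Z, rfl, rfl, rfl, h⟩ := isTransforComp_zero_iff.1 k
        rfl
      | succ j =>
        obtain ⟨_, _, X, Y, Z, rfl, rfl, rfl, h⟩ := isTransforComp_succ_iff.1 k
        rw [s_succ, t_succ, h.match_])
    (hs := by
      intro p X Y Z k
      cases p using Fin.cases with
      | zero =>
        obtain ⟨_, _, _, X, Y, Z, rfl, rfl, rfl, h⟩ := isTransforComp_zero_iff.1 k
        rfl
      | succ j =>
        obtain ⟨_, _, X, Y, Z, rfl, rfl, rfl, h⟩ := isTransforComp_succ_iff.1 k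
        rw [s_succ, s_succ, h.s_eq])
    (ht := by
      intro p X Y Z k
      cases p using Fin.cases with
      | zero =>
        obtain ⟨_, _, _, X, Y, Z, rfl, rfl, rfl, h⟩ := isTransforComp_zero_iff.1 k
        rfl
      | succ j =>
        obtain ⟨_, _, X, Y, Z, rfl, rfl, rfl, h⟩ := isTransforComp_succ_iff.1 k
        rw [t_succ, t_succ, h.t_eq])
    (id_right := by
      intro p X
      cases p using Fin.cases with
      | zero =>
        exact isTransforComp_zero_iff.2 ⟨_, _, _, _, _, _, rfl, rfl, rfl, HComp.one_right _⟩
      | succ j =>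
        exact isTransforComp_succ_iff.2 ⟨_, _, _, _, _, rfl, rfl, rfl, VComp.id_right _ _⟩)
    (id_left := by
      intro p X
      cases p using Fin.cases with
      | zero =>
        exact isTransforComp_zero_iff.2 ⟨_, _, _, _, _, _, rfl, rfl, rfl, HComp.one_left _⟩
      | succ j =>
        exact isTransforComp_succ_iff.2 ⟨_, _, _, _, _, rfl, rfl, rfl, VComp.id_left _ _⟩)
    (assoc := by
      intro p X Y Z U V W k k' k''
      cases p using Fin.cases with
      | zero =>
        obtain ⟨_, _, _, X, Y, U, rfl, rfl, rfl, h⟩ := isTransforComp_zero_iff.1 k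
        obtain ⟨_, _, _, Y', Z, V, hY, rfl, rfl, h'⟩ := isTransforComp_zero_iff.1 k'
        obtain ⟨_, _, _, U', Z', W, hU, hZ, rfl, h''⟩ := isTransforComp_zero_iff.1 k''
        cases hY; cases hU; cases hZ
        exact isTransforComp_zero_iff.2 ⟨_, _, _, _, _, _, rfl, rfl, rfl, h.assoc h' h''⟩
      | succ j =>
        obtain ⟨_, _, X, Y, U, rfl, rfl, rfl, h⟩ := isTransforComp_succ_iff.1 k
        obtain ⟨_, _, Y', Z, V, hY, rfl, rfl, h'⟩ := isTransforComp_succ_iff.1 k'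
        obtain ⟨_, _, U', Z', W, hU, hZ, rfl, h''⟩ := isTransforComp_succ_iff.1 k''
        cases hY; cases hU; cases hZ
        exact isTransforComp_succ_iff.2 ⟨_, _, _, _, _, rfl, rfl, rfl, h.assoc h' h''⟩)
    (mono := by
      intro q p hqp X
      cases p using Fin.cases with
      | zero => exact absurd hqp (Fin.not_lt_zero _)
      | succ j =>
        cases q using Fin.cases with
        | zero =>
          rw [s_succ, s_zero]
          -- The components of the identity of an identity functor are objects, which are identities
          -- for every composition.
          refine congrArg (Cell.mk X.dom X.dom) (NTransfor.ext rfl (by simp [one]) fun A => ?_)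
          rcases (Fin.zero_le j).eq_or_lt with rfl | hj
          · exact isPartialId_iff.1 A.2
          · exact isPartialId_iff.1 (X.dom.str.id_mono _ _ hj _ A.2)
        | succ i =>
          rw [s_succ, s_succ]
          exact congrArg (Cell.mk X.dom X.cod)
            (NTransfor.s_s_of_lt (Fin.succ_lt_succ_iff.1 hqp) _))
    (hsR := by
      intro q p hqp X Y Z k
      cases p using Fin.cases with
      | zero => exact absurd hqp (Fin.not_lt_zero _)
      | succ j =>
        cases q using Fin.cases with
        | zero =>
          obtain ⟨_, _, _, X, Y, Z, rfl, rfl, rfl, h⟩ := isTransforComp_zero_iff.1 k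
          exact isTransforComp_zero_iff.2 ⟨_, _, _, _, _, _, rfl, rfl, rfl, h.s j⟩
        | succ i =>
          obtain ⟨_, _, X, Y, Z, rfl, rfl, rfl, h⟩ := isTransforComp_succ_iff.1 k
          exact isTransforComp_succ_iff.2 ⟨_, _, _, _, _, rfl, rfl, rfl,
            h.s_of_lt (Fin.succ_lt_succ_iff.1 hqp)⟩)
    (exch := by
      intro q p hqp X Y W Z a b c ka kb kc
      cases p using Fin.cases with
      | zero => exact absurd hqp (Fin.not_lt_zero _)
      | succ j =>
        obtain ⟨_, _, X, Y, a, rfl, rfl, rfl, ha⟩ := isTransforComp_succ_iff.1 ka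
        obtain ⟨_, _, W, Z, b, rfl, rfl, rfl, hb⟩ := isTransforComp_succ_iff.1 kb
        cases q using Fin.cases with
        | zero =>
          obtain ⟨_, _, _, a', b', c, ha', hb', rfl, hc⟩ := isTransforComp_zero_iff.1 kc
          cases ha'; cases hb'
          obtain ⟨d, e, hd, he, hde⟩ := HComp.exchange ha hb hc
          exact ⟨_, _, isTransforComp_zero_iff.2 ⟨_, _, _, _, _, _, rfl, rfl, rfl, hd⟩,
            isTransforComp_zero_iff.2 ⟨_, _, _, _, _, _, rfl, rfl, rfl, he⟩,
            isTransforComp_succ_iff.2 ⟨_, _, _, _, _, rfl, rfl, rfl, hde⟩⟩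
        | succ i =>
          obtain ⟨_, _, a', b', c, ha', hb', rfl, hc⟩ := isTransforComp_succ_iff.1 kc
          cases ha'; cases hb'
          obtain ⟨d, e, hd, he, hde⟩ := VComp.exchange (Fin.succ_lt_succ_iff.1 hqp) ha hb hc
          exact ⟨_, _, isTransforComp_succ_iff.2 ⟨_, _, _, _, _, rfl, rfl, rfl, hd⟩,
            isTransforComp_succ_iff.2 ⟨_, _, _, _, _, rfl, rfl, rfl, he⟩,
            isTransforComp_succ_iff.2 ⟨_, _, _, _, _, rfl, rfl, rfl, hde⟩⟩)

lemma mem_comp_iff {p : Fin (m + 1 + 1)} {X Y Z : Cell.{u} m} :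
    Z ∈ (globular m).comp p X Y ↔ IsTransforComp p X Y Z := mem_ofRel_comp

lemma globular_s (p : Fin (m + 1 + 1)) (X : Cell.{u} m) : (globular m).s p X = X.s p :=
  ofRel_s p X

lemma globular_t (p : Fin (m + 1 + 1)) (X : Cell.{u} m) : (globular m).t p X = X.t p :=
  ofRel_t p X

end Cell

end HigherCStar

namespace HigherCStar

open GlobularCategory

variable {m : ℕ} {C D E : SmallLR.{u} m}

/-! ### Linear structure and involution on transfors -/

namespace NTransfor

/-- `Z` is the componentwise sum of `X` and `Y`. -/
structure IsSum (X Y Z : NTransfor C D) : Prop where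
  src_eq : X.src = Y.src
  tgt_eq : X.tgt = Y.tgt
  src : Z.src = X.src
  tgt : Z.tgt = X.tgt
  map : ∀ A, Z.map A ∈ D.str.add (X.map A) (Y.map A)

/-- Componentwise scalar multiples. -/
def smul (c : ℂ) (X : NTransfor C D) : NTransfor C D where
  src := X.src
  tgt := X.tgt
  map A := D.str.smul c (X.map A)
  isTransfor := (X.isBoundedNat.smul c).isTransfor_top

/-- The componentwise involution. -/
@[simps] def star (X : NTransfor C D) : NTransfor C D where
  src := if m = 0 then X.tgt else X.src
  tgt := if m = 0 then X.src else X.tgt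
  map A := D.str.star (X.map A)
  isTransfor := by
    apply IsBoundedNat.isTransfor_top
    split_ifs with h
    · exact X.isBoundedNat.star_zero h
    · exact X.isBoundedNat.star h

lemma last_eq_zero_iff : Fin.last m = 0 ↔ m = 0 := by simp [Fin.ext_iff]

lemma star_star (X : NTransfor C D) : X.star.star = X := by
  refine ext ?_ ?_ fun A => D.str.star_star _
  all_goals by_cases h : m = 0 <;> simp [h]

/-- The components are identities, hence selfadjoint. For `n = 1` the involution swaps the boundary
functors, which are equal for an identity transfor. -/
lemma star_eq_self {X : NTransfor C D} (h : X.s (Fin.last m) = X) : X.star = X := by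
  have h1 : m = 0 → X.src = X.tgt := fun hm => by
    have := congrArg NTransfor.tgt h
    rwa [s_tgt, if_pos (last_eq_zero_iff.2 hm)] at this
  refine ext ?_ ?_ fun A => D.str.star_id _ (isPartialId_iff.2 ?_)
  · by_cases hm : m = 0
    · rw [star_src, if_pos hm, h1 hm]
    · rw [star_src, if_neg hm]
  · by_cases hm : m = 0
    · rw [star_tgt, if_pos hm, h1 hm]
    · rw [star_tgt, if_neg hm]
  · exact congrFun (congrArg NTransfor.map h) A

/-- The supremum norm of a transfor. -/
noncomputable def supNorm (X : NTransfor C D) : ℝ := ⨆ A, D.str.norm (X.map A)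

lemma norm_map_le (X : NTransfor C D) (A : C.Obj) : D.str.norm (X.map A) ≤ X.supNorm :=
  X.isBoundedNat.bounded.norm_le A

lemma supNorm_nonneg (X : NTransfor C D) : 0 ≤ X.supNorm :=
  Real.iSup_nonneg fun _ => D.str.pre.norm_nonneg _

lemma VComp.supNorm_le {j : Fin (m + 1)} {X Y Z : NTransfor C D} (h : VComp j X Y Z) :
    Z.supNorm ≤ X.supNorm * Y.supNorm :=
  -- `Real.iSup_le` asks for a nonnegative bound and thereby covers a category without objects,
  -- where the supremum is `0`.
  Real.iSup_le (fun A => (D.str.norm_comp_le _ _ _ _ (h.map A)).trans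
    (mul_le_mul (X.norm_map_le A) (Y.norm_map_le A) (D.str.pre.norm_nonneg _) X.supNorm_nonneg))
    (mul_nonneg X.supNorm_nonneg Y.supNorm_nonneg)

lemma HComp.supNorm_le {X : NTransfor D E} {Y : NTransfor C D} {Z : NTransfor C E}
    (h : HComp X Y Z) : Z.supNorm ≤ X.supNorm * Y.supNorm :=
  Real.iSup_le (fun A => (E.str.norm_comp_le _ _ _ _ (h.map A)).trans
    (mul_le_mul (X.norm_map_le _) ((X.src.norm_map_le _).trans (Y.norm_map_le A))
      (E.str.pre.norm_nonneg _) X.supNorm_nonneg))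
    (mul_nonneg X.supNorm_nonneg Y.supNorm_nonneg)

lemma VComp.supNorm_star_comp {X Z : NTransfor C D} (h : VComp (Fin.last m) X.star X Z) :
    Z.supNorm = X.supNorm ^ 2 := by
  have h1 : ∀ A, D.str.norm (Z.map A) = D.str.norm (X.map A) ^ 2 :=
    fun A => D.str.norm_star_comp_self _ _ (h.map A)
  refine le_antisymm (Real.iSup_le (fun A => ?_) (sq_nonneg _)) ?_
  · rw [h1]
    exact pow_le_pow_left₀ (D.str.pre.norm_nonneg _) (X.norm_map_le A) 2
  -- Taking square roots turns the bound on the squared supremum into a bound on each component.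
  · rw [← Real.le_sqrt X.supNorm_nonneg Z.supNorm_nonneg]
    refine Real.iSup_le (fun A => ?_) (Real.sqrt_nonneg _)
    rw [Real.le_sqrt (D.str.pre.norm_nonneg _) Z.supNorm_nonneg, ← h1]
    exact Z.norm_map_le A

namespace IsSum

variable {X Y Z Z' : NTransfor C D}

lemma unique (h : IsSum X Y Z) (h' : IsSum X Y Z') : Z = Z' :=
  ext (h.src.trans h'.src.symm) (h.tgt.trans h'.tgt.symm)
    fun A => Part.mem_unique (h.map A) (h'.map A)

lemma exists_of_forall (src : X.src = Y.src) (tgt : X.tgt = Y.tgt)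
    (h : ∀ A, ∃ z, z ∈ D.str.add (X.map A) (Y.map A)) : ∃ Z, IsSum X Y Z := by
  choose Z hZ using h
  have hY := Y.isBoundedNat
  rw [← src, ← tgt] at hY
  exact ⟨ofIsBoundedNat (X.isBoundedNat.add hY hZ), src, tgt, rfl, rfl, hZ⟩

lemma exists_iff : (∃ Z, IsSum X Y Z) ↔
    X.s (Fin.last m) = Y.s (Fin.last m) ∧ X.t (Fin.last m) = Y.t (Fin.last m) := by
  constructor
  · rintro ⟨Z, h⟩
    refine ⟨ext h.src_eq ?_ fun A => PreLR.s_eq_of_add (P := D.str.pre) _ (h.map A),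
      ext ?_ h.tgt_eq fun A => PreLR.t_eq_of_add (P := D.str.pre) _ (h.map A)⟩
    · rw [s_tgt, s_tgt, h.src_eq, h.tgt_eq]
    · rw [t_src, t_src, h.src_eq, h.tgt_eq]
  · rintro ⟨h1, h2⟩
    have hsrc := congrArg NTransfor.src h1
    have htgt := congrArg NTransfor.tgt h2
    refine exists_of_forall hsrc htgt fun A => ?_
    have h3 : D.str.s (Fin.last m) (X.map A) = D.str.s (Fin.last m) (Y.map A) :=
      congrFun (congrArg NTransfor.map h1) A
    have h4 : D.str.t (Fin.last m) (X.map A) = D.str.t (Fin.last m) (Y.map A) :=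
      congrFun (congrArg NTransfor.map h2) A
    obtain ⟨z, -, hz⟩ := PreLR.exists_add (P := D.str.pre) (mem_block_self D.str.1 (X.map A))
      (mem_block_iff.2 ⟨h4.symm, h3.symm⟩)
    exact ⟨z, hz⟩

lemma star (h : IsSum X Y Z) : IsSum X.star Y.star Z.star where
  src_eq := by rw [star_src, star_src, h.src_eq, h.tgt_eq]
  tgt_eq := by rw [star_tgt, star_tgt, h.src_eq, h.tgt_eq]
  src := by rw [star_src, star_src, h.src, h.tgt]
  tgt := by rw [star_tgt, star_tgt, h.src, h.tgt]
  map A := D.str.star_add _ _ _ (h.map A)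

end IsSum

/-! ### Compatibility of the compositions with linear operations and involution. -/

section Bilinear

variable {j : Fin (m + 1)}

lemma VComp.add_left {X X' Y U a b : NTransfor C D} (h : IsSum X X' U) (ha : VComp j X Y a)
    (hb : VComp j X' Y b) : ∃ v, VComp j U Y v ∧ IsSum a b v := by
  have H := fun A => D.str.add_comp _ _ _ _ _ _ _ (h.map A) (ha.map A) (hb.map A)
  obtain ⟨v, hv⟩ : ∃ v, VComp j U Y v := VComp.exists_of_forall
    (by rw [h.src]; exact ha.middle) (by rw [h.src, h.tgt]; exact ha.bdry)
    fun A => (H A).imp fun _ hv => hv.1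
  refine ⟨v, hv, ha.src.trans hb.src.symm, by rw [ha.tgt, hb.tgt, h.tgt_eq],
    hv.src.trans ha.src.symm, by rw [hv.tgt, ha.tgt, h.tgt], fun A => ?_⟩
  obtain ⟨v', hv', hv''⟩ := H A
  rwa [comp_unique (hv.map A) hv']

lemma VComp.add_right {X Y Y' U a b : NTransfor C D} (h : IsSum Y Y' U) (ha : VComp j X Y a)
    (hb : VComp j X Y' b) : ∃ v, VComp j X U v ∧ IsSum a b v := by
  have H := fun A => D.str.comp_add _ _ _ _ _ _ _ (h.map A) (ha.map A) (hb.map A)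
  obtain ⟨v, hv⟩ : ∃ v, VComp j X U v := VComp.exists_of_forall
    (by rw [h.tgt]; exact ha.middle) (by rw [h.src, h.tgt]; exact ha.bdry)
    fun A => (H A).imp fun _ hv => hv.1
  refine ⟨v, hv, by rw [ha.src, hb.src, h.src_eq], ha.tgt.trans hb.tgt.symm,
    by rw [hv.src, ha.src, h.src], hv.tgt.trans ha.tgt.symm, fun A => ?_⟩
  obtain ⟨v', hv', hv''⟩ := H A
  rwa [comp_unique (hv.map A) hv']

lemma VComp.smul_left (c : ℂ) {X Y Z : NTransfor C D} (h : VComp j X Y Z) :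
    VComp j (X.smul c) Y (Z.smul c) :=
  ⟨h.middle, h.bdry, h.src, h.tgt, fun A => D.str.smul_comp _ _ _ _ _ (h.map A)⟩

lemma VComp.smul_right (c : ℂ) {X Y Z : NTransfor C D} (h : VComp j X Y Z) :
    VComp j X (Y.smul c) (Z.smul c) :=
  ⟨h.middle, h.bdry, h.src, h.tgt, fun A => D.str.comp_smul _ _ _ _ _ (h.map A)⟩

lemma VComp.star_last {X Y Z : NTransfor C D} (h : VComp (Fin.last m) X Y Z) :
    VComp (Fin.last m) Y.star X.star Z.star where
  middle hj := by
    rw [last_eq_zero_iff] at hj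
    rw [star_src, star_tgt, if_pos hj, if_pos hj, h.middle (last_eq_zero_iff.2 hj)]
  bdry hj := by
    rw [star_src, star_tgt, star_src, star_tgt, (h.bdry hj).1, (h.bdry hj).2]
    exact ⟨rfl, rfl⟩
  src := by
    by_cases hm : m = 0
    · simp [hm, h.tgt]
    · simp [hm, h.src, h.bdry (fun h => hm (last_eq_zero_iff.1 h))]
  tgt := by
    by_cases hm : m = 0
    · simp [hm, h.src]
    · simp [hm, h.tgt, h.bdry (fun h => hm (last_eq_zero_iff.1 h))]
  map A := D.str.star_comp_top _ _ _ (h.map A)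

lemma VComp.star (hj : j < Fin.last m) {X Y Z : NTransfor C D} (h : VComp j X Y Z) :
    VComp j X.star Y.star Z.star := by
  have hm : m ≠ 0 := fun hm => (Fin.zero_le j).not_gt (last_eq_zero_iff.2 hm ▸ hj)
  constructor
  · simpa [hm] using h.middle
  · simpa [hm] using h.bdry
  · simpa [hm] using h.src
  · simpa [hm] using h.tgt
  · exact fun A => D.str.star_comp _ hj _ _ _ (h.map A)

lemma HComp.add_left {X X' U : NTransfor D E} {Y : NTransfor C D} {a b : NTransfor C E}
    (h : IsSum X X' U) (ha : HComp X Y a) (hb : HComp X' Y b) :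
    ∃ v, HComp U Y v ∧ IsSum a b v := by
  obtain ⟨v, hv⟩ := exists_hcomp U Y
  refine ⟨v, hv, by rw [ha.src, hb.src, h.src_eq], by rw [ha.tgt, hb.tgt, h.tgt_eq],
    by rw [ha.src, hv.src, h.src], by rw [ha.tgt, hv.tgt, h.tgt], fun A => ?_⟩
  have h2 := hb.map A
  rw [← h.src_eq] at h2
  have h3 := hv.map A
  rw [h.src] at h3
  obtain ⟨v', hv', hv''⟩ := E.str.add_comp _ _ _ _ _ _ _ (h.map _) (ha.map A) h2
  rwa [comp_unique h3 hv']

lemma HComp.add_right {X : NTransfor D E} {Y Y' U : NTransfor C D} {a b : NTransfor C E}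
    (h : IsSum Y Y' U) (ha : HComp X Y a) (hb : HComp X Y' b) :
    ∃ v, HComp X U v ∧ IsSum a b v := by
  obtain ⟨v, hv⟩ := exists_hcomp X U
  refine ⟨v, hv, by rw [ha.src, hb.src, h.src_eq], by rw [ha.tgt, hb.tgt, h.tgt_eq],
    by rw [ha.src, hv.src, h.src], by rw [ha.tgt, hv.tgt, h.tgt], fun A => ?_⟩
  have h2 := hb.map A
  rw [← h.tgt_eq] at h2
  have h3 := hv.map A
  rw [h.tgt] at h3
  obtain ⟨v', hv', hv''⟩ := E.str.comp_add _ _ _ _ _ _ _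
    (X.src.map_add _ _ _ (h.map A)) (ha.map A) h2
  rwa [comp_unique h3 hv']

lemma HComp.smul_left (c : ℂ) {X : NTransfor D E} {Y : NTransfor C D} {Z : NTransfor C E}
    (h : HComp X Y Z) : HComp (X.smul c) Y (Z.smul c) :=
  ⟨h.src, h.tgt, fun A => E.str.smul_comp _ _ _ _ _ (h.map A)⟩

lemma HComp.smul_right (c : ℂ) {X : NTransfor D E} {Y : NTransfor C D} {Z : NTransfor C E}
    (h : HComp X Y Z) : HComp X (Y.smul c) (Z.smul c) :=
  ⟨h.src, h.tgt, fun A => by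
    have := E.str.comp_smul _ c _ _ _ (h.map A)
    rwa [← StarFunctor.map_smul] at this⟩

/-- For `n = 1` the involution reverses the two factors of each component, and naturality of `X*` at
the cell `Y*(A)` restores their order. For `n ≥ 2` it is covariant for `∘₀`. -/
lemma HComp.star {X : NTransfor D E} {Y : NTransfor C D} {Z : NTransfor C E}
    (h : HComp X Y Z) : HComp X.star Y.star Z.star := by
  by_cases hm : m = 0
  · refine ⟨by simp [hm, h.tgt], by simp [hm, h.src], fun A => ?_⟩
    have hN := X.star.isBoundedNat.isNat.comp_eq (Y.star.map A)
    rw [sObj_map, tObj_map] at hN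
    rw [← hN]
    have h0 : (0 : Fin (m + 1)) = Fin.last m := (last_eq_zero_iff.2 hm).symm
    have h1 := h.map A
    rw [h0] at h1 ⊢
    have h2 := E.str.star_comp_top _ _ _ h1
    rw [← StarFunctor.map_star] at h2
    simpa [hm] using h2
  · refine ⟨by simp [hm, h.src], by simp [hm, h.tgt], fun A => ?_⟩
    have h0 : 0 < Fin.last m := Fin.pos_iff_ne_zero.2 fun h => hm (last_eq_zero_iff.1 h)
    have h2 := E.str.star_comp _ h0 _ _ _ (h.map A)
    rw [← StarFunctor.map_star] at h2
    simpa [hm] using h2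

end Bilinear

/-! ### Blocks of transfors -/

section Block

variable {a b : NTransfor C D}

/-- The componentwise form of the hypothesis that two identity transfors are parallel. -/
structure IsFrame (a b : NTransfor C D) : Prop where
  par : ∀ A, D.str.pre.Parallel (a.map A) (b.map A)
  bdry : Fin.last m ≠ 0 → a.src = b.src ∧ a.tgt = b.tgt
  left : Fin.last m = 0 → a.src = a.tgt
  right : Fin.last m = 0 → b.src = b.tgt

namespace IsFrame

variable {Ξ : C.Obj → D.carrier}

/-- All sources of a family in these blocks are sources of `b`, all targets are targets of `a`, and
these are natural already. -/
lemma isBoundedNat (h : IsFrame a b) (hb : ∀ A, Ξ A ∈ D.str.block (a.map A) (b.map A))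
    (hN : IsNat b.src a.tgt Ξ) (hB : IsBoundedFamily Ξ) : IsBoundedNat b.src a.tgt Ξ := by
  have hm : ∀ j : Fin (m + 1), j ≠ 0 → Fin.last m ≠ 0 := fun j hj h =>
    hj (Fin.le_zero_iff.1 (h ▸ Fin.le_last j))
  refine ⟨hN, hB, fun j hj => ?_, fun j hj => ?_⟩
  · have h1 := b.isBoundedNat.isNat_s j hj
    rw [← (h.bdry (hm j hj)).2] at h1
    simpa only [s_of_mem_block (hb _)] using h1
  · have h1 := a.isBoundedNat.isNat_t j hj
    rw [(h.bdry (hm j hj)).1] at h1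
    simpa only [t_of_mem_block (hb _)] using h1

/-- The two sides of the intertwining condition are elements of the same block. -/
lemma exists_block (h : IsFrame a b) (x : C.carrier) :
    ∃ a' b', D.str.pre.Parallel a' b' ∧
      (∀ y ∈ D.str.block (a.map (C.sObj x)) (b.map (C.sObj x)),
        ∃ w ∈ D.str.block a' b', w ∈ D.str.comp 0 (a.tgt.toFun x) y) ∧
      (∀ y ∈ D.str.block (a.map (C.tObj x)) (b.map (C.tObj x)),
        ∃ w ∈ D.str.block a' b', w ∈ D.str.comp 0 y (b.src.toFun x)) := by
  suffices H : ∃ a' b',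
      (∀ y ∈ D.str.block (a.map (C.sObj x)) (b.map (C.sObj x)),
        ∃ w ∈ D.str.block a' b', w ∈ D.str.comp 0 (a.tgt.toFun x) y) ∧
      (∀ y ∈ D.str.block (a.map (C.tObj x)) (b.map (C.tObj x)),
        ∃ w ∈ D.str.block a' b', w ∈ D.str.comp 0 y (b.src.toFun x)) by
    obtain ⟨a', b', H1, H2⟩ := H
    obtain ⟨w, hw, -⟩ := H1 _ (0 : D.str.pre.Blk (h.par (C.sObj x))).2
    exact ⟨a', b', parallel_of_mem_block hw, H1, H2⟩
  have ex1 : ∀ y ∈ D.str.block (a.map (C.sObj x)) (b.map (C.sObj x)),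
      ∃ w, w ∈ D.str.comp 0 (a.tgt.toFun x) y := fun y hy => exists_comp (by
    rw [t_of_mem_block hy, t_zero_map, ← StarFunctor.map_s]; rfl)
  have ex2 : ∀ y ∈ D.str.block (a.map (C.tObj x)) (b.map (C.tObj x)),
      ∃ w, w ∈ D.str.comp 0 y (b.src.toFun x) := fun y hy => exists_comp (by
    rw [s_of_mem_block hy, s_zero_map, ← StarFunctor.map_t]; rfl)
  by_cases hm : Fin.last m = 0
  -- For `n = 1` the components of `a` and `b` are objects, and both composites run from `b` at the
  -- source of `x` to `a` at its target.
  · have ha : ∀ A, a.map A = a.tgt.toFun A.1 := fun A => by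
      rw [← t_zero_map, ← hm, PreLR.t_last_of_parallel (h.par A)]
    have hb : ∀ A, b.map A = b.src.toFun A.1 := fun A => by
      rw [← s_zero_map, ← hm, (parallel_iff.1 (h.par A)).2.1]
    refine ⟨a.map (C.tObj x), b.map (C.sObj x), fun y hy => ?_, fun y hy => ?_⟩
    · obtain ⟨w, hw⟩ := ex1 y hy
      refine ⟨w, mem_block_iff.2 ⟨?_, ?_⟩, hw⟩
      · rw [hm, t_of_comp hw, ha, ← StarFunctor.map_t]; rfl
      · rw [hm, s_comp hw, ← hm, (mem_block_iff.1 hy).2]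
    · obtain ⟨w, hw⟩ := ex2 y hy
      refine ⟨w, mem_block_iff.2 ⟨?_, ?_⟩, hw⟩
      · rw [hm, t_of_comp hw, ← hm, (mem_block_iff.1 hy).1]
      · rw [hm, s_comp hw, hb, ← StarFunctor.map_s]; rfl
  · have h0 : 0 < Fin.last m := Fin.pos_iff_ne_zero.2 hm
    -- For `n ≥ 2` the `(n-1)`-targets of the two composites are the two sides of the square of `a`
    -- at the `(n-1)`-target of `x`; the sources are those of the square of `b` at its
    -- `(n-1)`-source.
    obtain ⟨a', ha1, ha2⟩ := a.isBoundedNat.isNat.exists_both (C.str.t (Fin.last m) x)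
    obtain ⟨b', hb1, hb2⟩ := b.isBoundedNat.isNat.exists_both (C.str.s (Fin.last m) x)
    rw [SmallLR.sObj_congr (s_t_of_gt h0 x)] at ha1
    rw [SmallLR.tObj_congr (t_t_of_gt h0 x), (h.bdry hm).1] at ha2
    rw [SmallLR.sObj_congr (s_s_of_gt h0 x), ← (h.bdry hm).2] at hb1
    rw [SmallLR.tObj_congr (t_s_of_gt h0 x)] at hb2
    rw [StarFunctor.map_t] at ha1 ha2
    rw [StarFunctor.map_s] at hb1 hb2
    refine ⟨a', b', fun y hy => ?_, fun y hy => ?_⟩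
    · obtain ⟨w, hw⟩ := ex1 y hy
      obtain ⟨hy1, hy2⟩ := mem_block_iff.1 hy
      have h1 := t_comp_of_gt h0 hw
      have h2 := s_comp_of_gt h0 hw
      rw [hy1] at h1
      rw [hy2] at h2
      exact ⟨w, mem_block_iff.2 ⟨comp_unique h1 ha1, comp_unique h2 hb1⟩, hw⟩
    · obtain ⟨w, hw⟩ := ex2 y hy
      obtain ⟨hy1, hy2⟩ := mem_block_iff.1 hy
      have h1 := t_comp_of_gt h0 hw
      have h2 := s_comp_of_gt h0 hw
      rw [hy1] at h1
      rw [hy2] at h2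
      exact ⟨w, mem_block_iff.2 ⟨comp_unique h1 ha2, comp_unique h2 hb2⟩, hw⟩

/-- The bounded families of elements of the blocks between the components of `a` and `b`. -/
abbrev Families (h : IsFrame a b) : Type u :=
  lp (fun A : C.Obj => D.str.pre.Blk (h.par A)) ⊤

/-- The bounded families which are natural. -/
noncomputable def naturalFamilies (h : IsFrame a b) : Submodule ℂ h.Families where
  carrier := {f | IsNat b.src a.tgt fun A => (f A).1}
  add_mem' {f g} hf hg := IsNat.add hf hg fun A => PreLR.Blk.add_mem (f A) (g A)
  smul_mem' c f hf := by
    have h1 : ∀ A, ((c • f) A).1 = D.str.smul c (f A).1 := fun A => PreLR.Blk.coe_smul c (f A)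
    change IsNat b.src a.tgt fun A => ((c • f) A).1
    simpa only [h1] using IsNat.smul c hf
  zero_mem' := by
    refine IsNat.mk' (fun A => ?_) (fun A => ?_) fun x w w' hw hw' => ?_
    · rw [s_of_mem_block ((0 : h.Families) A).2, s_zero_map]
    · rw [t_of_mem_block ((0 : h.Families) A).2, t_zero_map]
    -- Composition with a fixed cell is linear, so both sides are the zero of their common block.
    · obtain ⟨a', b', hp, H1, H2⟩ := h.exists_block x
      have h1 := PreLR.compLeft_mem (h := h.par _) (h' := hp) H1 0
      have h2 := PreLR.compRight_mem (h := h.par _) (h' := hp) H2 0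
      rw [map_zero] at h1 h2
      exact (comp_unique hw h1).trans (comp_unique hw' h2).symm

/-- Each cell `x` imposes the equality of two continuous maps: evaluation at an end of `x` followed
by composition with a fixed cell. -/
lemma isClosed_naturalFamilies (h : IsFrame a b) :
    IsClosed (h.naturalFamilies : Set h.Families) := by
  choose a' b' hp H1 H2 using h.exists_block
  have : (h.naturalFamilies : Set h.Families) = ⋂ x,
      {f | PreLR.compLeft _ _ (h.par _) (hp x) (H1 x) (f (C.sObj x)) =
        PreLR.compRight _ _ (h.par _) (hp x) (H2 x) (f (C.tObj x))} := by
    ext f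
    simp only [Set.mem_iInter, Set.mem_ofPred_eq]
    have h1 := fun x => PreLR.compLeft_mem (h := h.par _) (h' := hp x) (H1 x) (f (C.sObj x))
    have h2 := fun x => PreLR.compRight_mem (h := h.par _) (h' := hp x) (H2 x) (f (C.tObj x))
    constructor
    · intro (hf : IsNat b.src a.tgt fun A => (f A).1) x
      exact PreLR.Blk.ext (comp_unique (h1 x) (hf.comp_eq x ▸ h2 x))
    · intro hf
      refine IsNat.mk' (fun A => ?_) (fun A => ?_) fun x w w' hw hw' => ?_
      · rw [s_of_mem_block (f A).2, s_zero_map]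
      · rw [t_of_mem_block (f A).2, t_zero_map]
      · rw [comp_unique hw (h1 x), comp_unique hw' (h2 x), hf x]
  rw [this]
  refine isClosed_iInter fun x => isClosed_eq ?_ ?_
  · exact (ContinuousLinearMap.continuous _).comp (lp.evalCLM ℂ _ ⊤ (C.sObj x)).continuous
  · exact (ContinuousLinearMap.continuous _).comp (lp.evalCLM ℂ _ ⊤ (C.tObj x)).continuous

instance (h : IsFrame a b) : CompleteSpace h.naturalFamilies :=
  h.isClosed_naturalFamilies.completeSpace_coe

lemma isBoundedNat_of_mem (h : IsFrame a b) (f : h.naturalFamilies) :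
    IsBoundedNat b.src a.tgt fun A => (f.1 A).1 := by
  refine h.isBoundedNat (fun A => (f.1 A).2) f.2 ?_
  obtain ⟨M, hM⟩ := memℓp_infty_iff.1 (lp.memℓp f.1)
  exact .of_le fun A => (PreLR.Blk.norm_def (f.1 A)).symm.trans_le (hM ⟨A, rfl⟩)

/-- The transfor given by a bounded natural family. -/
def toNTransfor (h : IsFrame a b) (f : h.naturalFamilies) : NTransfor C D :=
  ofIsBoundedNat (h.isBoundedNat_of_mem f)

lemma s_toNTransfor (h : IsFrame a b) (f : h.naturalFamilies) :
    (h.toNTransfor f).s (Fin.last m) = b := by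
  refine ext rfl ?_ fun A => (mem_block_iff.1 (f.1 A).2).2
  rw [s_tgt]
  split_ifs with hm
  · exact h.right hm
  · exact (h.bdry hm).2

lemma t_toNTransfor (h : IsFrame a b) (f : h.naturalFamilies) :
    (h.toNTransfor f).t (Fin.last m) = a := by
  refine ext ?_ rfl fun A => (mem_block_iff.1 (f.1 A).2).1
  rw [t_src]
  split_ifs with hm
  · exact (h.left hm).symm
  · exact (h.bdry hm).1.symm

lemma exists_toNTransfor_eq (h : IsFrame a b) {X : NTransfor C D} (hs : X.s (Fin.last m) = b)
    (ht : X.t (Fin.last m) = a) : ∃ f, h.toNTransfor f = X := by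
  have hX : ∀ A, X.map A ∈ D.str.block (a.map A) (b.map A) := fun A =>
    mem_block_iff.2 ⟨congrFun (congrArg NTransfor.map ht) A, congrFun (congrArg NTransfor.map hs) A⟩
  have h1 : X.src = b.src := by rw [← hs]; rfl
  have h2 : X.tgt = a.tgt := by rw [← ht]; rfl
  have hm : Memℓp (fun A => PreLR.Blk.mk (h.par A) (X.map A) (hX A)) ⊤ := by
    refine memℓp_infty ?_
    simp only [PreLR.Blk.norm_def]
    exact X.isBoundedNat.bounded
  have hN := X.isBoundedNat.isNat
  rw [h1, h2] at hN
  exact ⟨⟨⟨_, hm⟩, hN⟩, ext h1.symm h2.symm fun A => rfl⟩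

lemma toNTransfor_injective (h : IsFrame a b) : Function.Injective h.toNTransfor := by
  intro f g hfg
  refine Subtype.ext (lp.ext (funext fun A => PreLR.Blk.ext ?_))
  exact congrFun (congrArg NTransfor.map hfg) A

lemma isSum_toNTransfor (h : IsFrame a b) (f g : h.naturalFamilies) :
    IsSum (h.toNTransfor f) (h.toNTransfor g) (h.toNTransfor (f + g)) :=
  ⟨rfl, rfl, rfl, rfl, fun A => PreLR.Blk.add_mem (f.1 A) (g.1 A)⟩

lemma toNTransfor_smul (h : IsFrame a b) (c : ℂ) (f : h.naturalFamilies) :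
    h.toNTransfor (c • f) = (h.toNTransfor f).smul c :=
  ext rfl rfl fun A => PreLR.Blk.coe_smul c (f.1 A)

lemma norm_eq_supNorm (h : IsFrame a b) (f : h.naturalFamilies) :
    ‖f‖ = (h.toNTransfor f).supNorm := by
  refine (lp.norm_eq_ciSup f.1).trans ?_
  exact iSup_congr fun A => PreLR.Blk.norm_def (f.1 A)

end IsFrame

end Block

end NTransfor

end HigherCStar

namespace HigherCStar

open GlobularCategory NTransfor

variable {m : ℕ} {C D E : SmallLR.{u} m}

/-! ### The C*-structure on transfors -/

lemma isTransforAdd_iff {X Y Z : Cell.{u} m} : IsTransforAdd X Y Z ↔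
    ∃ (C D : SmallLR.{u} m) (X' Y' Z' : NTransfor C D),
      X = ⟨C, D, X'⟩ ∧ Y = ⟨C, D, Y'⟩ ∧ Z = ⟨C, D, Z'⟩ ∧ IsSum X' Y' Z' := by
  constructor
  · rintro ⟨X, Y, Z, sl, sr, tl, tr, map⟩
    exact ⟨_, _, _, _, _, rfl, rfl, rfl, sl.symm.trans sr, tl.symm.trans tr, sl, tl, map⟩
  · rintro ⟨C, D, X', Y', Z', rfl, rfl, rfl, h⟩
    exact ⟨_, _, _, h.src, h.src.trans h.src_eq, h.tgt, h.tgt.trans h.tgt_eq, h.map⟩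

namespace Cell

/-- Addition of transfors. -/
noncomputable def add (X Y : Cell.{u} m) : Part (Cell.{u} m) :=
  ⟨∃ Z, IsTransforAdd X Y Z, fun h => h.choose⟩

/-- Scalar multiplication of transfors. -/
def smul (c : ℂ) (X : Cell.{u} m) : Cell.{u} m := ⟨X.dom, X.cod, X.transfor.smul c⟩

/-- The involution of transfors. -/
def star (X : Cell.{u} m) : Cell.{u} m := ⟨X.dom, X.cod, X.transfor.star⟩

lemma mem_add_iff {X Y Z : Cell.{u} m} : Z ∈ X.add Y ↔ IsTransforAdd X Y Z := by
  constructor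
  · rintro ⟨h, rfl⟩
    exact h.choose_spec
  · intro h
    refine ⟨⟨Z, h⟩, ?_⟩
    have h' : IsTransforAdd X Y _ := Exists.choose_spec (⟨Z, h⟩ : ∃ Z, IsTransforAdd X Y Z)
    obtain ⟨_, _, X', Y', Z', rfl, rfl, rfl, k⟩ := isTransforAdd_iff.1 h
    obtain ⟨_, _, X'', Y'', Z'', hX, hY, hZ, k'⟩ := isTransforAdd_iff.1 h'
    cases hX
    cases hY
    exact hZ.trans (by rw [k.unique k'])

lemma mem_block_iff {X a b : Cell.{u} m} : X ∈ (globular m).block a b ↔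
    X.t (Fin.last m).succ = a ∧ X.s (Fin.last m).succ = b := by
  rw [GlobularCategory.mem_block_iff, globular_s, globular_t, Fin.succ_last]

lemma mk_inj {X Y : NTransfor C D} : (⟨C, D, X⟩ : Cell.{u} m) = ⟨C, D, Y⟩ ↔ X = Y := by simp

/-- Levels of cells are those of components shifted by one. Equal `∘₁`-boundaries determine the
functors if `n ≥ 2`; if `n = 1`, a `∘₁`-identity has equal boundary functors. -/
lemma isFrame_of_parallel {a b : NTransfor C D}
    (h : (globular m).Parallel ⟨C, D, a⟩ ⟨C, D, b⟩) : IsFrame a b := by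
  obtain ⟨ha, hb, hp⟩ := parallel_iff.1 h
  rw [globular_s, ← Fin.succ_last, s_succ, mk_inj] at ha hb
  have hp' : ∀ p < Fin.last m, a.s p = b.s p ∧ a.t p = b.t p := fun p hlt => by
    have := hp p.succ (by rw [← Fin.succ_last]; exact Fin.succ_lt_succ_iff.2 hlt)
    simpa only [globular_s, globular_t, s_succ, t_succ, mk_inj] using this
  refine ⟨fun A => parallel_iff.2 ⟨congrFun (congrArg NTransfor.map ha) A,
    congrFun (congrArg NTransfor.map hb) A, fun p hlt =>
      ⟨congrFun (congrArg NTransfor.map (hp' p hlt).1) A,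
        congrFun (congrArg NTransfor.map (hp' p hlt).2) A⟩⟩, fun hm => ?_, fun hm => ?_, fun hm => ?_⟩
  · obtain ⟨h1, h2⟩ := hp' 0 (Fin.pos_iff_ne_zero.2 hm)
    have h3 := congrArg NTransfor.src h1
    have h4 := congrArg NTransfor.tgt h2
    exact ⟨h3, h4⟩
  · have h1 := congrArg NTransfor.tgt ha
    rwa [NTransfor.s_tgt, if_pos hm] at h1
  · have h1 := congrArg NTransfor.tgt hb
    rwa [NTransfor.s_tgt, if_pos hm] at h1

lemma dom_cod_of_parallel {a b : Cell.{u} m} (h : (globular m).Parallel a b) :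
    a.dom = b.dom ∧ a.cod = b.cod := by
  obtain ⟨h1, h2⟩ := (parallel_iff.1 h).2.2 0 (Fin.last_pos)
  rw [globular_s, globular_s] at h1
  rw [globular_t, globular_t] at h2
  have h3 := congrArg Cell.dom h1
  have h4 := congrArg Cell.dom h2
  exact ⟨h3, h4⟩

/-- The natural bounded families between two parallel transfors are the elements of a block. -/
noncomputable def blockEquiv {a b : NTransfor C D} (h : IsFrame a b) :
    h.naturalFamilies ≃ (globular m).block ⟨C, D, a⟩ ⟨C, D, b⟩ :=
  Equiv.ofBijective (fun f => ⟨⟨C, D, h.toNTransfor f⟩, mem_block_iff.2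
    ⟨by rw [t_succ, h.t_toNTransfor], by rw [s_succ, h.s_toNTransfor]⟩⟩) <| by
    constructor
    · intro f g hfg
      exact h.toNTransfor_injective (mk_inj.1 (congrArg Subtype.val hfg))
    · rintro ⟨⟨C', D', X⟩, hX⟩
      obtain ⟨h1, h2⟩ := mem_block_iff.1 hX
      obtain rfl : C' = C := congrArg Cell.dom h1
      obtain rfl : D' = D := congrArg Cell.cod h1
      obtain ⟨f, rfl⟩ := h.exists_toNTransfor_eq (mk_inj.1 h2) (mk_inj.1 h1)
      exact ⟨f, rfl⟩

lemma coe_blockEquiv {a b : NTransfor C D} (h : IsFrame a b) (f : h.naturalFamilies) :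
    (blockEquiv h f).1 = ⟨C, D, h.toNTransfor f⟩ := rfl

/-- The structure is transported along `blockEquiv` from the closed subspace of natural families. -/
lemma exists_banach (a b : Cell.{u} m) (h : (globular m).Parallel a b) :
    ∃ (_ : NormedAddCommGroup ((globular m).block a b))
      (_ : NormedSpace ℂ ((globular m).block a b)),
      CompleteSpace ((globular m).block a b) ∧
      (∀ x y : (globular m).block a b,
        ((x + y : (globular m).block a b) : Cell.{u} m) ∈ add x.1 y.1) ∧
      (∀ (c : ℂ) (x : (globular m).block a b),
        ((c • x : (globular m).block a b) : Cell.{u} m) = smul c x.1) ∧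
      (∀ x : (globular m).block a b, ‖x‖ = supNorm x.1) := by
  obtain ⟨C, D, a⟩ := a
  obtain ⟨C', D', b⟩ := b
  obtain ⟨h1, h2⟩ := dom_cod_of_parallel h
  obtain rfl : C = C' := h1
  obtain rfl : D = D' := h2
  have hf := isFrame_of_parallel h
  let e := (blockEquiv hf).symm
  let i1 := e.normedAddCommGroup
  let i2 := e.normedSpace ℂ
  refine ⟨i1, i2, ?_, fun x y => ?_, fun c x => ?_, fun x => ?_⟩
  · have hu : IsUniformEmbedding e := ⟨⟨rfl⟩, e.injective⟩
    exact (completeSpace_congr hu).2 inferInstance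
  · obtain ⟨f, rfl⟩ := (blockEquiv hf).surjective x
    obtain ⟨g, rfl⟩ := (blockEquiv hf).surjective y
    have h3 : blockEquiv hf f + blockEquiv hf g = blockEquiv hf (f + g) := by
      rw [Equiv.add_def]; simp [e]
    rw [h3]
    exact mem_add_iff.2 (isTransforAdd_iff.2 ⟨_, _, _, _, _, rfl, rfl, rfl,
      hf.isSum_toNTransfor f g⟩)
  · obtain ⟨f, rfl⟩ := (blockEquiv hf).surjective x
    have h3 : c • blockEquiv hf f = blockEquiv hf (c • f) := by
      rw [Equiv.smul_def]; simp [e]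
    rw [h3, coe_blockEquiv, hf.toNTransfor_smul]
    rfl
  · obtain ⟨f, rfl⟩ := (blockEquiv hf).surjective x
    have h3 : ‖blockEquiv hf f‖ = ‖e (blockEquiv hf f)‖ := rfl
    rw [h3, Equiv.symm_apply_apply]
    exact hf.norm_eq_supNorm f

/-- The structure on bounded transfors, without positivity. -/
noncomputable def preLR (m : ℕ) : PreLR (m + 1) (Cell.{u} m) where
  toGlobularCategory := globular m
  star := star
  add := add
  smul := smul
  norm := supNorm
  add_dom X Y := by
    simp only [mem_block_iff]
    constructor
    · rintro ⟨Z, h⟩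
      obtain ⟨C, D, X, Y, Z, rfl, rfl, rfl, k⟩ := isTransforAdd_iff.1 h
      obtain ⟨h1, h2⟩ := IsSum.exists_iff.1 ⟨Z, k⟩
      exact ⟨_, _, ⟨rfl, rfl⟩, by rw [t_succ, t_succ, h2], by rw [s_succ, s_succ, h1]⟩
    · rintro ⟨_, _, ⟨rfl, rfl⟩, h1, h2⟩
      obtain ⟨C, D, X⟩ := X
      obtain ⟨C', D', Y⟩ := Y
      obtain rfl : C' = C := congrArg Cell.dom h1
      obtain rfl : D' = D := congrArg Cell.cod h1
      rw [t_succ, t_succ, mk_inj] at h1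
      rw [s_succ, s_succ, mk_inj] at h2
      obtain ⟨Z, hZ⟩ := IsSum.exists_iff.2 ⟨h2.symm, h1.symm⟩
      exact ⟨_, isTransforAdd_iff.2 ⟨_, _, _, _, _, rfl, rfl, rfl, hZ⟩⟩
  banach := exists_banach
  add_comp p X X' Y U a b hU ha hb := by
    simp only [mem_add_iff, mem_comp_iff] at hU ha hb ⊢
    obtain ⟨_, _, X, X', U, rfl, rfl, rfl, kU⟩ := isTransforAdd_iff.1 hU
    cases p using Fin.cases with
    | zero =>
      obtain ⟨_, _, _, Z, Y, a, hX, rfl, rfl, ka⟩ := isTransforComp_zero_iff.1 ha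
      cases hX
      obtain ⟨_, _, _, Z', Y', b, hX, hY, rfl, kb⟩ := isTransforComp_zero_iff.1 hb
      cases hX; cases hY
      obtain ⟨v, h1, h2⟩ := HComp.add_left kU ka kb
      exact ⟨_, isTransforComp_zero_iff.2 ⟨_, _, _, _, _, _, rfl, rfl, rfl, h1⟩,
        isTransforAdd_iff.2 ⟨_, _, _, _, _, rfl, rfl, rfl, h2⟩⟩
    | succ j =>
      obtain ⟨_, _, Z, Y, a, hX, rfl, rfl, ka⟩ := isTransforComp_succ_iff.1 ha
      cases hX
      obtain ⟨_, _, Z', Y', b, hX, hY, rfl, kb⟩ := isTransforComp_succ_iff.1 hb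
      cases hX; cases hY
      obtain ⟨v, h1, h2⟩ := VComp.add_left kU ka kb
      exact ⟨_, isTransforComp_succ_iff.2 ⟨_, _, _, _, _, rfl, rfl, rfl, h1⟩,
        isTransforAdd_iff.2 ⟨_, _, _, _, _, rfl, rfl, rfl, h2⟩⟩
  comp_add p X Y Y' U a b hU ha hb := by
    simp only [mem_add_iff, mem_comp_iff] at hU ha hb ⊢
    obtain ⟨_, _, Y, Y', U, rfl, rfl, rfl, kU⟩ := isTransforAdd_iff.1 hU
    cases p using Fin.cases with
    | zero =>
      obtain ⟨_, _, _, X, Z, a, rfl, hY, rfl, ka⟩ := isTransforComp_zero_iff.1 ha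
      cases hY
      obtain ⟨_, _, _, X', Z', b, hX, hY, rfl, kb⟩ := isTransforComp_zero_iff.1 hb
      cases hX; cases hY
      obtain ⟨v, h1, h2⟩ := HComp.add_right kU ka kb
      exact ⟨_, isTransforComp_zero_iff.2 ⟨_, _, _, _, _, _, rfl, rfl, rfl, h1⟩,
        isTransforAdd_iff.2 ⟨_, _, _, _, _, rfl, rfl, rfl, h2⟩⟩
    | succ j =>
      obtain ⟨_, _, X, Z, a, rfl, hY, rfl, ka⟩ := isTransforComp_succ_iff.1 ha
      cases hY
      obtain ⟨_, _, X', Z', b, hX, hY, rfl, kb⟩ := isTransforComp_succ_iff.1 hb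
      cases hX; cases hY
      obtain ⟨v, h1, h2⟩ := VComp.add_right kU ka kb
      exact ⟨_, isTransforComp_succ_iff.2 ⟨_, _, _, _, _, rfl, rfl, rfl, h1⟩,
        isTransforAdd_iff.2 ⟨_, _, _, _, _, rfl, rfl, rfl, h2⟩⟩
  smul_comp p c X Y Z h := by
    rw [mem_comp_iff] at h ⊢
    cases p using Fin.cases with
    | zero =>
      obtain ⟨_, _, _, X, Y, Z, rfl, rfl, rfl, k⟩ := isTransforComp_zero_iff.1 h
      exact isTransforComp_zero_iff.2 ⟨_, _, _, _, _, _, rfl, rfl, rfl, k.smul_left c⟩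
    | succ j =>
      obtain ⟨_, _, X, Y, Z, rfl, rfl, rfl, k⟩ := isTransforComp_succ_iff.1 h
      exact isTransforComp_succ_iff.2 ⟨_, _, _, _, _, rfl, rfl, rfl, k.smul_left c⟩
  comp_smul p c X Y Z h := by
    rw [mem_comp_iff] at h ⊢
    cases p using Fin.cases with
    | zero =>
      obtain ⟨_, _, _, X, Y, Z, rfl, rfl, rfl, k⟩ := isTransforComp_zero_iff.1 h
      exact isTransforComp_zero_iff.2 ⟨_, _, _, _, _, _, rfl, rfl, rfl, k.smul_right c⟩
    | succ j =>
      obtain ⟨_, _, X, Y, Z, rfl, rfl, rfl, k⟩ := isTransforComp_succ_iff.1 h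
      exact isTransforComp_succ_iff.2 ⟨_, _, _, _, _, rfl, rfl, rfl, k.smul_right c⟩
  norm_comp_le p X Y Z h := by
    rw [mem_comp_iff] at h
    cases p using Fin.cases with
    | zero =>
      obtain ⟨_, _, _, X, Y, Z, rfl, rfl, rfl, k⟩ := isTransforComp_zero_iff.1 h
      exact k.supNorm_le
    | succ j =>
      obtain ⟨_, _, X, Y, Z, rfl, rfl, rfl, k⟩ := isTransforComp_succ_iff.1 h
      exact k.supNorm_le
  star_star X := congrArg (Cell.mk X.dom X.cod) X.transfor.star_star
  star_id e he := by
    rw [isPartialId_iff, globular_s, ← Fin.succ_last] at he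
    exact congrArg (Cell.mk e.dom e.cod) (NTransfor.star_eq_self (mk_inj.1 he))
  star_add X Y Z h := by
    rw [mem_add_iff] at h ⊢
    obtain ⟨_, _, X, Y, Z, rfl, rfl, rfl, k⟩ := isTransforAdd_iff.1 h
    exact isTransforAdd_iff.2 ⟨_, _, _, _, _, rfl, rfl, rfl, k.star⟩
  star_smul c X := congrArg (Cell.mk X.dom X.cod)
    (NTransfor.ext rfl rfl fun A => X.cod.str.star_smul c _)
  star_comp_top X Y Z h := by
    rw [mem_comp_iff, ← Fin.succ_last] at h ⊢
    obtain ⟨_, _, X, Y, Z, rfl, rfl, rfl, k⟩ := isTransforComp_succ_iff.1 h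
    exact isTransforComp_succ_iff.2 ⟨_, _, _, _, _, rfl, rfl, rfl, k.star_last⟩
  star_comp p hp X Y Z h := by
    rw [mem_comp_iff] at h ⊢
    cases p using Fin.cases with
    | zero =>
      obtain ⟨_, _, _, X, Y, Z, rfl, rfl, rfl, k⟩ := isTransforComp_zero_iff.1 h
      exact isTransforComp_zero_iff.2 ⟨_, _, _, _, _, _, rfl, rfl, rfl, k.star⟩
    | succ j =>
      obtain ⟨_, _, X, Y, Z, rfl, rfl, rfl, k⟩ := isTransforComp_succ_iff.1 h
      rw [← Fin.succ_last, Fin.succ_lt_succ_iff] at hp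
      exact isTransforComp_succ_iff.2 ⟨_, _, _, _, _, rfl, rfl, rfl, k.star hp⟩
  norm_star_comp_self X Z h := by
    rw [mem_comp_iff, ← Fin.succ_last] at h
    obtain ⟨_, _, Y, X, Z, hY, rfl, rfl, k⟩ := isTransforComp_succ_iff.1 h
    obtain rfl := mk_inj.1 hY
    exact k.supNorm_star_comp

/-! ### Evaluation at objects and positivity. -/

section Eval

variable {e : NTransfor C D} {h : (preLR m).Parallel ⟨C, D, e⟩ ⟨C, D, e⟩}

/-- The domain and codomain of a cell in the block equal `C` and `D` only propositionally; this
provides a transfor of the right type with components to evaluate. -/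
lemma exists_mk_eq (X : (preLR m).Blk h) : ∃ X' : NTransfor C D, ⟨C, D, X'⟩ = X.1 := by
  obtain ⟨f, hf⟩ := (blockEquiv (isFrame_of_parallel h)).surjective X
  exact ⟨_, congrArg Subtype.val hf⟩

/-- The transfor underlying an endomorphism of an identity transfor. -/
noncomputable def repr (X : (preLR m).Blk h) : NTransfor C D := (exists_mk_eq X).choose

lemma mk_repr (X : (preLR m).Blk h) : ⟨C, D, repr X⟩ = X.1 := (exists_mk_eq X).choose_spec

lemma repr_s (X : (preLR m).Blk h) : (repr X).s (Fin.last m) = e := by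
  have := (mem_block_iff.1 X.2).2
  rwa [← mk_repr, s_succ, mk_inj] at this

lemma repr_t (X : (preLR m).Blk h) : (repr X).t (Fin.last m) = e := by
  have := (mem_block_iff.1 X.2).1
  rwa [← mk_repr, t_succ, mk_inj] at this

lemma repr_map_mem_block (X : (preLR m).Blk h) (A : C.Obj) :
    (repr X).map A ∈ D.str.block (e.map A) (e.map A) :=
  GlobularCategory.mem_block_iff.2 ⟨congrFun (congrArg NTransfor.map (repr_t X)) A,
    congrFun (congrArg NTransfor.map (repr_s X)) A⟩

lemma isSum_repr (X Y : (preLR m).Blk h) : IsSum (repr X) (repr Y) (repr (X + Y)) := by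
  have h1 := mem_add_iff.1 (PreLR.Blk.add_mem X Y)
  rw [← mk_repr, ← mk_repr, ← mk_repr] at h1
  obtain ⟨_, _, X', Y', Z', hX, hY, hZ, k⟩ := isTransforAdd_iff.1 h1
  cases hX; cases hY; cases hZ
  exact k

lemma vcomp_repr (X Y : (preLR m).Blk h) :
    VComp (Fin.last m) (repr X) (repr Y) (repr (X * Y)) := by
  have h1 := mem_comp_iff.1 (PreLR.Blk.mul_mem X Y)
  rw [← mk_repr, ← mk_repr, ← mk_repr, ← Fin.succ_last] at h1
  obtain ⟨_, _, X', Y', Z', hX, hY, hZ, k⟩ := isTransforComp_succ_iff.1 h1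
  cases hX; cases hY; cases hZ
  exact k

lemma repr_smul (c : ℂ) (X : (preLR m).Blk h) : repr (c • X) = (repr X).smul c := by
  have h1 : (c • X).1 = smul c X.1 := PreLR.Blk.coe_smul c X
  rw [← mk_repr, ← mk_repr] at h1
  exact mk_inj.1 h1

lemma repr_star (X : (preLR m).Blk h) : repr (Star.star X) = (repr X).star := by
  have h1 : (Star.star X).1 = star X.1 := PreLR.Blk.coe_star X
  rw [← mk_repr, ← mk_repr] at h1
  exact mk_inj.1 h1

/-- Joint faithfulness of the evaluations: inside the block the boundary functors are fixed by `e`.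
-/
lemma blk_ext {X Y : (preLR m).Blk h} (hXY : ∀ A, (repr X).map A = (repr Y).map A) : X = Y := by
  refine PreLR.Blk.ext ?_
  rw [← mk_repr, ← mk_repr, mk_inj]
  refine NTransfor.ext ?_ ?_ hXY
  · have h1 := congrArg NTransfor.src ((repr_s X).trans (repr_s Y).symm)
    exact h1
  · have h1 := congrArg NTransfor.tgt ((repr_t X).trans (repr_t Y).symm)
    exact h1

/-- Evaluation of endomorphisms of an identity transfor at an object. -/
noncomputable def evalHom (h : (preLR m).Parallel ⟨C, D, e⟩ ⟨C, D, e⟩)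
    (A : C.Obj) (hA : D.str.pre.Parallel (e.map A) (e.map A)) :
    (preLR m).Blk h →⋆ₙₐ[ℂ] D.str.pre.Blk hA where
  toFun X := PreLR.Blk.mk hA ((repr X).map A) (repr_map_mem_block X A)
  map_smul' c X := PreLR.Blk.ext ((congrFun (congrArg NTransfor.map (repr_smul c X)) A).trans
    (PreLR.Blk.coe_smul c (PreLR.Blk.mk hA _ (repr_map_mem_block X A))).symm)
  map_zero' := by
    have h0 := (isSum_repr (0 : (preLR m).Blk h) 0).map A
    rw [add_zero] at h0
    exact left_eq_add.1 (PreLR.Blk.eq_add (z := PreLR.Blk.mk hA _ (repr_map_mem_block 0 A)) h0)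
  map_add' X Y := PreLR.Blk.eq_add ((isSum_repr X Y).map A)
  map_mul' X Y := PreLR.Blk.eq_mul ((vcomp_repr X Y).map A)
  map_star' X := PreLR.Blk.ext (congrFun (congrArg NTransfor.map (repr_star X)) A)

end Eval

/-- `Z = X* ∘ X` is a selfadjoint endomorphism of `e` with components `X(A)* ∘ X(A)`, positive by
the axiom in the target category; the jointly faithful evaluations lift positivity to `Z`. -/
lemma exists_star_comp_self_eq (X e Z : Cell.{u} m)
    (he : IsSource ((globular m).comp (Fin.last (m + 1))) X e)
    (hZ : Z ∈ (globular m).comp (Fin.last (m + 1)) (star X) X) :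
    ∃ Y ∈ (globular m).block e e, Z ∈ (globular m).comp (Fin.last (m + 1)) (star Y) Y := by
  have hes : (globular m).s (Fin.last (m + 1)) e = e := isPartialId_iff.1 he.1
  rw [isSource_iff] at he
  have hZb : Z ∈ (preLR m).block e e := GlobularCategory.mem_block_iff.2
    ⟨(t_of_comp hZ).trans ((PreLR.t_last_star (P := preLR m) X).trans he), (s_comp hZ).trans he⟩
  have hZs : star Z = Z := by
    have h1 := (preLR m).star_comp_top _ _ _ hZ
    have h2 : (preLR m).star (star X) = X := (preLR m).star_star X
    rw [h2] at h1
    exact comp_unique h1 hZ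
  rw [globular_s, ← Fin.succ_last] at he
  subst he
  obtain ⟨C, D, X⟩ := X
  have hpar : (preLR m).Parallel ⟨C, D, X.s (Fin.last m)⟩ ⟨C, D, X.s (Fin.last m)⟩ :=
    parallel_self hes
  have hA : ∀ A, D.str.pre.Parallel ((X.s (Fin.last m)).map A) ((X.s (Fin.last m)).map A) :=
    fun A => parallel_self (s_s _ _)
  let z : (preLR m).Blk hpar := PreLR.Blk.mk hpar Z hZb
  obtain ⟨y, hy⟩ := exists_eq_star_mul_self_of_forall (fun A => evalHom hpar A (hA A))
    (fun x hx => blk_ext fun A => congrArg Subtype.val ((hx A).trans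
      (map_zero (evalHom hpar A (hA A))).symm))
    (z := z) (PreLR.Blk.ext hZs) fun A => by
      have h1 : Z = ⟨C, D, repr z⟩ := (mk_repr z).symm
      rw [mem_comp_iff, ← Fin.succ_last, h1] at hZ
      obtain ⟨_, _, X', Y', Z', hX, hY, hZ', k⟩ := isTransforComp_succ_iff.1 hZ
      cases hX; cases hY; cases hZ'
      -- Positivity in the target category enters only here.
      obtain ⟨y, hy, hy'⟩ := D.str.star_comp_self_pos _ _ _ (isSource_s _ _ _) (k.map A)
      exact ⟨PreLR.Blk.mk (hA A) y hy, PreLR.Blk.eq_mul hy'⟩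
  refine ⟨y.1, y.2, ?_⟩
  have h1 := PreLR.Blk.mul_mem (Star.star y) y
  rw [← hy] at h1
  exact h1

/-- The higher C*-category of bounded transfors. -/
noncomputable def lrStructure (m : ℕ) : LRStructure (m + 1) (Cell.{u} m) where
  toGlobularCategory := globular m
  star := star
  add := add
  smul := smul
  norm := supNorm
  add_dom := (preLR m).add_dom
  banach := (preLR m).banach
  add_comp := (preLR m).add_comp
  comp_add := (preLR m).comp_add
  smul_comp := (preLR m).smul_comp
  comp_smul := (preLR m).comp_smul
  norm_comp_le := (preLR m).norm_comp_le
  star_star := (preLR m).star_star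
  star_id := (preLR m).star_id
  star_add := (preLR m).star_add
  star_smul := (preLR m).star_smul
  star_comp_top := (preLR m).star_comp_top
  star_comp := (preLR m).star_comp
  norm_star_comp_self := (preLR m).norm_star_comp_self
  star_comp_self_pos := exists_star_comp_self_eq

end Cell

end HigherCStar

theorem mainTheorem7 (m : ℕ) :
    ∃ S : HigherCStar.LRStructure (m + 1) (HigherCStar.Cell.{u} m),
      (∀ (k : Fin (m + 1 + 1)) (X Y Z : HigherCStar.Cell.{u} m),
        Z ∈ S.comp k X Y ↔ HigherCStar.IsTransforComp k X Y Z) ∧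
      (∀ X Y Z : HigherCStar.Cell.{u} m, Z ∈ S.add X Y ↔ HigherCStar.IsTransforAdd X Y Z) ∧
      (∀ (c : ℂ) (X : HigherCStar.Cell.{u} m), HigherCStar.IsTransforSMul c X (S.smul c X)) ∧
      (∀ X : HigherCStar.Cell.{u} m, HigherCStar.IsTransforStar X (S.star X)) ∧
      (∀ X : HigherCStar.Cell.{u} m, S.norm X = X.supNorm) := by
  refine ⟨HigherCStar.Cell.lrStructure m, fun k X Y Z => HigherCStar.Cell.mem_comp_iff,
    fun X Y Z => HigherCStar.Cell.mem_add_iff, fun c X => .mk _ _ rfl rfl fun _ => rfl,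
    fun X => ?_, fun _ => rfl⟩
  by_cases hm : m = 0
  · exact .swap hm _ _ (if_pos hm) (if_pos hm) fun _ => rfl
  · exact .keep hm _ _ (if_neg hm) (if_neg hm) fun _ => rfl
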